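/- **Setting.** Let $-\infty<A<B<\infty$, $b>0$, $y_0\in(A,B)$, and let $p,r$ be real-valued with $p,p',r,r'\in AC_{loc}(A,B)$ (absolutely continuous on compact subintervals) and $p,r>0$ on $(A,B)$. Put $$\rho=(pr)^{1/4},\qquad l(y)=\int_{y_0}^{y}\sqrt{r(s)/p(s)}\,ds ,$$ and suppose that $\int_A^{y_0}\sqrt{r/p}\,ds=\int_{y_0}^B\sqrt{r/p}\,ds=b$ and that $\rho$ is continuous and nonvanishing on $[A,B]$, so that $L[v]=(\rho v)\circ l^{-1}$ is an invertible operator from $C[A,B]$ onto $C[-b,b]$. Let $q$ be complex-valued and let $Q\in C[-b,b]$ be the transformed potential: for a.e. $y\in(A,B)$ $$Q(l(y))=\frac{q(y)}{r(y)}-\Big(\frac{p(y)}{r(y)^{3}}\Big)^{1/4}\big[p\,\{(pr)^{-1/4}\}'\big]'(y).$$ Solutions of $(pv')'-qv=-\lambda rv$ on $(A,B)$ are understood with $v,pv'\in AC_{loc}(A,B)$ and the equation holding a.e. Let $\|\cdot\|$ be the maximum norm on $[A,B]$ and $\rho_0=\|1/\rho\|$. Let $g\in C[A,B]$ be a solution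 of $(pg')'-qg=0$ with $g(y_0)=(p(y_0)r(y_0))^{-1/4}$, such that $g$ and $p$ do not vanish on $[A,B]$ and $g^2r$, $1/(g^2p)$ are continuous on $[A,B]$. Define $\widetilde Y^{(0)}=Y^{(0)}=1$ and, for $k\ge1$, $$\widetilde Y^{(k)}(y)=k\int_{y_0}^y\widetilde Y^{(k-1)}\cdot\begin{cases}g^2r,&k\text{ odd}\\ 1/(g^2p),&k\text{ even}\end{cases}ds,\qquad Y^{(k)}(y)=k\int_{y_0}^yY^{(k-1)}\cdot\begin{cases}1/(g^2p),&k\text{ odd}\\ g^2r,&k\text{ even}\end{cases}ds,$$ and $\Phi_k=gY^{(k)}$ for $k$ odd, $\Phi_k=g\widetilde Y^{(k)}$ for $k$ even. Put $$h=\sqrt{\tfrac{p(y_0)}{r(y_0)}}\Big(\tfrac{g'(y_0)}{g(y_0)}+\tfrac{\rho'(y_0)}{\rho(y_0)}\Big),\qquad G_2(y)=\frac14\int_{y_0}^y\frac1\rho\Big\{\frac q\rho-[p(\rho^{-1})']'\Big\}ds,\qquad G_1=\frac h2+G_2,$$ $$\widetilde{\mathbf c}_m=\rho\sum_{\text{even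 }k=0}^m\binom mk l^k\Phi_{m-k},\qquad \widetilde{\mathbf s}_m=\rho\sum_{\text{odd }k=1}^m\binom mk l^k\Phi_{m-k}.$$ Let $N\ge0$, and let $a_0,\dots,a_N$, $b_1,\dots,b_N\in\mathbb C$ satisfy, for all $y\in[A,B]$, $$\Big|G_1(y)-\sum_{n=0}^Na_n\widetilde{\mathbf c}_n(y)\Big|\le\varepsilon_1,\qquad\Big|G_2(y)-\sum_{n=1}^Nb_n\widetilde{\mathbf s}_n(y)\Big|\le\varepsilon_2 .$$ For $\omega\in\mathbb C\setminus\{0\}$ let $v_1,v_2\in C[A,B]$ be the solutions of $(pv')'-qv=-\omega^2rv$ on $(A,B)$ with $$v_1(y_0)=\tfrac1{\rho(y_0)},\quad v_1'(y_0)=-\tfrac{\rho'(y_0)}{\rho^2(y_0)}+\tfrac h{\rho(y_0)}\sqrt{\tfrac{r(y_0)}{p(y_0)}},\qquad v_2(y_0)=0,\quad v_2'(y_0)=\tfrac1{\rho(y_0)}\sqrt{\tfrac{r(y_0)}{p(y_0)}},$$ and define $$v_{1,N}(\omega,y)=\frac{\cos(\omega l(y))}{\rho(y)}+2\sum_{n=0}^Na_n\sum_{\text{even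 }k=0}^n\binom nk\Phi_{n-k}(y)\int_0^{l(y)}t^k\cos\omega t\,dt,$$ $$v_{2,N}(\omega,y)=\frac1\omega\Big(\frac{\sin(\omega l(y))}{\rho(y)}+2\sum_{n=1}^Nb_n\sum_{\text{odd }k=1}^n\binom nk\Phi_{n-k}(y)\int_0^{l(y)}t^k\sin\omega t\,dt\Big).$$ **Theorem.** There is a number $\varepsilon=\varepsilon(\varepsilon_1,\varepsilon_2)\ge0$ that depends only on $\varepsilon_1,\varepsilon_2$ and $Q$ (including its domain $[-b,b]$), with $\varepsilon\to0$ as $(\varepsilon_1,\varepsilon_2)\to(0,0)$, such that for all $C\ge0$ and all $\omega\ne0$ with $|\operatorname{Im}\omega|\le C$ $$\|v_1-v_{1,N}\|\le\frac{\varepsilon\rho_0\sinh(Cb)}{C},\qquad\|v_2-v_{2,N}\|\le\frac{\varepsilon\rho_0\sinh(Cb)}{|\omega|C},$$ where $\sinh(Cb)/C$ is read as its limit $b$ when $C=0$. -/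

import Mathlib

open Set MeasureTheory Filter Topology

noncomputable section

namespace Liouville

/-- `f` is absolutely continuous on every compact subinterval of `(A, B)`. -/
def ACloc {X : Type*} [PseudoMetricSpace X] (A B : ℝ) (f : ℝ → X) : Prop :=
  ∀ c d : ℝ, A < c → c ≤ d → d < B → AbsolutelyContinuousOnInterval f c d

/-- `v` solves `(p v')' - q v = -lam r v` on `(A, B)` in the Carathéodory sense: `v` and `p v'` are
locally absolutely continuous and the equation holds almost everywhere. -/
structure IsSolution (A B : ℝ) (p r : ℝ → ℝ) (q : ℝ → ℂ) (lam : ℂ) (v : ℝ → ℂ) : Prop where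
  ac : ACloc A B v
  ac_quasi : ACloc A B (fun y => (p y : ℂ) * deriv v y)
  eqn : ∀ᵐ y ∂(volume.restrict (Ioo A B)),
    deriv (fun s => (p s : ℂ) * deriv v s) y - q y * v y = -lam * (r y : ℂ) * v y

/-- `ρ = (p r)^{1/4}`. -/
def rho (p r : ℝ → ℝ) (y : ℝ) : ℝ := (p y * r y) ^ (1 / 4 : ℝ)

/-- The Liouville change of variable `l(y) = ∫_{y₀}^y (r/p)^{1/2}`. -/
def ell (p r : ℝ → ℝ) (y₀ y : ℝ) : ℝ := ∫ s in y₀..y, Real.sqrt (r s / p s)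

/-- The conditions on `p`, `r`, `y₀` under which `l` maps `[A, B]` onto `[-b, b]` and
`v ↦ (ρ v) ∘ l⁻¹` is an invertible operator from `C[A, B]` onto `C[-b, b]`. -/
structure IsLiouville (A B b y₀ : ℝ) (p r : ℝ → ℝ) : Prop where
  mem : y₀ ∈ Ioo A B
  p_pos : ∀ y ∈ Ioo A B, 0 < p y
  r_pos : ∀ y ∈ Ioo A B, 0 < r y
  p_ac : ACloc A B p
  p'_ac : ACloc A B (deriv p)
  r_ac : ACloc A B r
  r'_ac : ACloc A B (deriv r)
  integrable : IntervalIntegrable (fun s => Real.sqrt (r s / p s)) volume A B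
  left_length : ∫ s in A..y₀, Real.sqrt (r s / p s) = b
  right_length : ∫ s in y₀..B, Real.sqrt (r s / p s) = b
  rho_cont : ContinuousOn (rho p r) (Icc A B)
  rho_ne_zero : ∀ y ∈ Icc A B, rho p r y ≠ 0

/-- `[p ((p r)^{-1/4})']'`. -/
def innerTerm (p r : ℝ → ℝ) (y : ℝ) : ℝ :=
  deriv (fun s => p s * deriv (fun τ => (p τ * r τ) ^ (-(1 / 4) : ℝ)) s) y

/-- `Q` is the potential of the Liouville-transformed equation `u'' - Q u = -lam u`:
`Q(l(y)) = q / r - (p / r³)^{1/4} [p ((p r)^{-1/4})']'`. The second derivatives of `p` and `r`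
exist only almost everywhere, so the identity is read almost everywhere. -/
def IsPotential (A B y₀ : ℝ) (p r : ℝ → ℝ) (q : ℝ → ℂ) (Q : ℝ → ℂ) : Prop :=
  ∀ᵐ y ∂(volume.restrict (Ioo A B)),
    Q (ell p r y₀ y) =
      q y / (r y : ℂ) - ((((r y ^ 3)⁻¹ * p y) ^ (1 / 4 : ℝ) * innerTerm p r y : ℝ) : ℂ)

/-- `g` is continuous and nonvanishing on `[A, B]`, `1 / (g² p)` is defined there, and
`g² r`, `1 / (g² p)` are continuous on `[A, B]`. -/
structure IsAdmissible (A B : ℝ) (p r : ℝ → ℝ) (g : ℝ → ℂ) : Prop where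
  cont : ContinuousOn g (Icc A B)
  ne_zero : ∀ y ∈ Icc A B, g y ≠ 0
  p_ne_zero : ∀ y ∈ Icc A B, p y ≠ 0
  cont_r : ContinuousOn (fun y => g y ^ 2 * (r y : ℂ)) (Icc A B)
  cont_p : ContinuousOn (fun y => 1 / (g y ^ 2 * (p y : ℂ))) (Icc A B)

/-- The auxiliary functions `Ỹ^{(k)}`. -/
def Ytilde (p r : ℝ → ℝ) (g : ℝ → ℂ) (y₀ : ℝ) : ℕ → ℝ → ℂ
  | 0 => fun _ => 1
  | k + 1 => fun y =>
      ((k + 1 : ℕ) : ℂ) * ∫ s in y₀..y, Ytilde p r g y₀ k s *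
        (if Odd (k + 1) then g s ^ 2 * (r s : ℂ) else 1 / (g s ^ 2 * (p s : ℂ)))

/-- The auxiliary functions `Y^{(k)}`. -/
def Y (p r : ℝ → ℝ) (g : ℝ → ℂ) (y₀ : ℝ) : ℕ → ℝ → ℂ
  | 0 => fun _ => 1
  | k + 1 => fun y =>
      ((k + 1 : ℕ) : ℂ) * ∫ s in y₀..y, Y p r g y₀ k s *
        (if Odd (k + 1) then 1 / (g s ^ 2 * (p s : ℂ)) else g s ^ 2 * (r s : ℂ))

/-- The formal powers `Φ_k`. -/
def Phi (p r : ℝ → ℝ) (g : ℝ → ℂ) (y₀ : ℝ) (k : ℕ) (y : ℝ) : ℂ :=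
  if Odd k then g y * Y p r g y₀ k y else g y * Ytilde p r g y₀ k y

/-- `h = (p/r)^{1/2} (g'/g + ρ'/ρ)` at `y₀`. -/
def hConst (p r : ℝ → ℝ) (g : ℝ → ℂ) (y₀ : ℝ) : ℂ :=
  (Real.sqrt (p y₀ / r y₀) : ℂ) *
    (deriv g y₀ / g y₀ + ((deriv (rho p r) y₀ / rho p r y₀ : ℝ) : ℂ))

/-- `G₂(y) = (1/4) ∫_{y₀}^y (p r)^{-1/4} { q / (p r)^{1/4} - [p ((p r)^{-1/4})']' }`. -/
def G₂ (p r : ℝ → ℝ) (q : ℝ → ℂ) (y₀ y : ℝ) : ℂ :=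
  1 / 4 * ∫ s in y₀..y,
    1 / (rho p r s : ℂ) * (q s / (rho p r s : ℂ) - (innerTerm p r s : ℂ))

/-- `G₁(y) = h / 2 + G₂(y)`. -/
def G₁ (p r : ℝ → ℝ) (q g : ℝ → ℂ) (y₀ y : ℝ) : ℂ :=
  hConst p r g y₀ / 2 + G₂ p r q y₀ y

/-- `c̃_m(y) = ρ(y) ∑_{even k ≤ m} binom(m, k) l(y)^k Φ_{m-k}(y)`; for `m = 0` this is `ρ g`. -/
def cTilde (p r : ℝ → ℝ) (g : ℝ → ℂ) (y₀ : ℝ) (m : ℕ) (y : ℝ) : ℂ :=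
  (rho p r y : ℂ) * ∑ k ∈ (Finset.range (m + 1)).filter (fun k => Even k),
    (m.choose k : ℂ) * (ell p r y₀ y : ℂ) ^ k * Phi p r g y₀ (m - k) y

/-- `s̃_m(y) = ρ(y) ∑_{odd k ≤ m} binom(m, k) l(y)^k Φ_{m-k}(y)`. -/
def sTilde (p r : ℝ → ℝ) (g : ℝ → ℂ) (y₀ : ℝ) (m : ℕ) (y : ℝ) : ℂ :=
  (rho p r y : ℂ) * ∑ k ∈ (Finset.range (m + 1)).filter (fun k => Odd k),
    (m.choose k : ℂ) * (ell p r y₀ y : ℂ) ^ k * Phi p r g y₀ (m - k) y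

/-- The approximation `v_{1,N}(ω, y)` with coefficients `a_0, …, a_N`. -/
def v₁N (p r : ℝ → ℝ) (g : ℝ → ℂ) (y₀ : ℝ) (a : ℕ → ℂ) (N : ℕ) (ω : ℂ) (y : ℝ) : ℂ :=
  1 / (rho p r y : ℂ) * Complex.cos (ω * (ell p r y₀ y : ℂ)) +
    2 * ∑ n ∈ Finset.range (N + 1), a n *
      ∑ k ∈ (Finset.range (n + 1)).filter (fun k => Even k),
        (n.choose k : ℂ) * Phi p r g y₀ (n - k) y *
          ∫ t in (0 : ℝ)..ell p r y₀ y, (t : ℂ) ^ k * Complex.cos (ω * (t : ℂ))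

/-- The approximation `v_{2,N}(ω, y)` with coefficients `b_1, …, b_N`. -/
def v₂N (p r : ℝ → ℝ) (g : ℝ → ℂ) (y₀ : ℝ) (b : ℕ → ℂ) (N : ℕ) (ω : ℂ) (y : ℝ) : ℂ :=
  1 / ω * (Complex.sin (ω * (ell p r y₀ y : ℂ)) / (rho p r y : ℂ) +
    2 * ∑ n ∈ Finset.Icc 1 N, b n *
      ∑ k ∈ (Finset.range (n + 1)).filter (fun k => Odd k),
        (n.choose k : ℂ) * Phi p r g y₀ (n - k) y *
          ∫ t in (0 : ℝ)..ell p r y₀ y, (t : ℂ) ^ k * Complex.sin (ω * (t : ℂ)))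

/-- The maximum norm on `[A, B]` (of a function continuous there). -/
def maxNorm (A B : ℝ) (f : ℝ → ℝ) : ℝ := sSup ((fun y => |f y|) '' Icc A B)

/-- `sinh(C b) / C`, with its limit value `b` at `C = 0`. -/
def sinhDiv (C b : ℝ) : ℝ := if C = 0 then b else Real.sinh (C * b) / C

end Liouville

end

namespace Liouville

/-! ### Hyperbolic and trigonometric bounds -/

/-! The Liouville transform U = (ρ v) ∘ l⁻¹ turns the equation into U'' = (Q - ω²) U on (-b, b), and
turns ρ Φ_k into functions φ_k with φ_k'' = Q φ_k + k (k - 1) φ_{k-2}. Hence u_n(x, t) = ∑ binom(n,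
k) φ_{n-k}(x) t^k, summed over k of one parity, solves the wave equation u_xx - Q u = u_tt; its
traces on the characteristic t = x are the functions c̃_n or s̃_n.

Take c(t) = cos ωt for even k and c(t) = sin ωt for odd k. Then W_n(x) = ∫_0^x u_n(x, t) c(t) dt
satisfies W_n'' = (Q - ω²) W_n + 2 (u_n(x, x))' c(x). Since G₁ and G₂ have derivative Q/4 in the new
variable, the error e = U - c - 2 ∑ a_n W_n solves e'' = (Q - ω²) e - 4 D' c with e(0) = 0 and e'(0)
= -2 D(0) c(0), where D is the sum of traces minus G, so that |D| ≤ ε.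

Only D is small, not D'. In Duhamel's formula with kernel sin(ω(x - s))/ω an integration by parts
removes the derivative from D. The trigonometric products that appear collapse, by an addition
formula, to a single sine or cosine of ω(x - 2s), and the integral of its bound cosh(C(x - 2s)) is
exactly sinh(Cx)/C. A Grönwall argument fitted to this kernel absorbs Q e at the cost of a factor
exp(M b²), with M a bound for |Q|. No transmutation kernel is needed.

The argument rests on `hasDerivAt_waveIntegral'`, `norm_le_of_residual_right` and
`le_of_le_integral_sinhDiv`. On the side of the original equation,
`IsLiouville.hasDerivAt_quasiDeriv` shows that the transformed equation holds classically, although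
p'' and r'' exist only almost everywhere. -/

theorem integral_cosh_mul (C x : ℝ) : ∫ t in (0 : ℝ)..x, Real.cosh (C * t) = sinhDiv C x := by
  unfold sinhDiv
  split_ifs with hC
  · simp [hC]
  · rw [intervalIntegral.integral_eq_sub_of_hasDerivAt (f := fun t => Real.sinh (C * t) / C)]
    · simp
    · intro t _
      have h := (((hasDerivAt_id t).const_mul C).sinh).div_const C
      simpa [hC] using h
    · exact (by fun_prop : Continuous fun t => Real.cosh (C * t)).intervalIntegrable _ _

/-- Source of the factor sinh(Cb)/C in the final estimate: cosh(C(x - 2s)) bounds the trigonometric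
factor left after the integration by parts in Duhamel's formula. -/
theorem integral_cosh_mul_sub (C x : ℝ) :
    ∫ s in (0 : ℝ)..x, Real.cosh (C * (x - 2 * s)) = sinhDiv C x := by
  unfold sinhDiv
  split_ifs with hC
  · simp [hC]
  · rw [intervalIntegral.integral_eq_sub_of_hasDerivAt
      (f := fun s => -(Real.sinh (C * (x - 2 * s)) / (2 * C)))]
    · have h : x - 2 * x = -x := by ring
      simp only [h, mul_neg, Real.sinh_neg, mul_zero, sub_zero]
      field_simp
      ring
    · intro s _
      have h := (((((hasDerivAt_id s).const_mul 2).const_sub x).const_mul C).sinh).div_const (2 * C)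
      convert! h.neg using 1
      simp only [id]
      field_simp
    · exact (by fun_prop : Continuous fun s => Real.cosh (C * (x - 2 * s))).intervalIntegrable _ _

theorem sinhDiv_zero_right (C : ℝ) : sinhDiv C 0 = 0 := by
  simp [← integral_cosh_mul]

theorem sinhDiv_mono (C : ℝ) : Monotone (sinhDiv C) := by
  intro x y hxy
  have hc : Continuous fun t => Real.cosh (C * t) := by fun_prop
  rw [← integral_cosh_mul, ← integral_cosh_mul, ← sub_nonneg,
    intervalIntegral.integral_interval_sub_left (hc.intervalIntegrable _ _)
      (hc.intervalIntegrable _ _)]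
  exact intervalIntegral.integral_nonneg hxy fun t _ => (Real.cosh_pos _).le

theorem sinhDiv_nonneg (C : ℝ) {x : ℝ} (hx : 0 ≤ x) : 0 ≤ sinhDiv C x :=
  sinhDiv_zero_right C ▸ sinhDiv_mono C hx

/-- Expand sinh(C(x - s) + Cs) and drop the nonnegative second term. This separates the variables x
and s in the Duhamel kernel. -/
theorem sinhDiv_sub_mul_cosh_le {C x s : ℝ} (hC : 0 ≤ C) (hs : 0 ≤ s) :
    sinhDiv C (x - s) * Real.cosh (C * s) ≤ sinhDiv C x := by
  unfold sinhDiv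
  split_ifs with h
  · simp [h, hs]
  · have hC' : 0 < C := lt_of_le_of_ne hC (Ne.symm h)
    rw [div_mul_eq_mul_div]
    refine div_le_div_of_nonneg_right ?_ hC
    have e : C * x = C * (x - s) + C * s := by ring
    rw [e, Real.sinh_add]
    have h1 : 0 ≤ Real.sinh (C * s) := Real.sinh_nonneg_iff.2 (by positivity)
    have h2 := Real.cosh_pos (C * (x - s))
    nlinarith

/-- The integrand cosh(Ct) is at most its value at the right end. The ratio of the two functions is
therefore at most x, which keeps the Grönwall exponent independent of C. -/
theorem sinhDiv_le_mul_cosh (C : ℝ) {x : ℝ} (hx : 0 ≤ x) :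
    sinhDiv C x ≤ x * Real.cosh (C * x) := by
  have hc : Continuous fun t => Real.cosh (C * t) := by fun_prop
  rw [← integral_cosh_mul]
  have := intervalIntegral.integral_mono_on (μ := volume) hx (hc.intervalIntegrable 0 x)
    (continuous_const.intervalIntegrable 0 x : IntervalIntegrable (fun _ => Real.cosh (C * x)) _ _ _)
    (fun t ht => by
      rw [Real.cosh_le_cosh, abs_mul, abs_mul, abs_of_nonneg ht.1, abs_of_nonneg hx]
      exact mul_le_mul_of_nonneg_left ht.2 (abs_nonneg C))
  simpa using this

theorem continuous_sinhDiv (C : ℝ) : Continuous (sinhDiv C) := by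
  have := intervalIntegral.continuous_primitive (μ := volume)
    (fun a b => (by fun_prop : Continuous fun t => Real.cosh (C * t)).intervalIntegrable a b) 0
  simpa only [integral_cosh_mul] using this

theorem norm_cos_le (z : ℂ) : ‖Complex.cos z‖ ≤ Real.cosh z.im := by
  rw [Complex.cos, norm_div, Real.cosh_eq]
  have h1 : ‖Complex.exp (z * Complex.I)‖ = Real.exp (-z.im) := by simp [Complex.norm_exp]
  have h2 : ‖Complex.exp (-z * Complex.I)‖ = Real.exp z.im := by simp [Complex.norm_exp]
  have := norm_add_le (Complex.exp (z * Complex.I)) (Complex.exp (-z * Complex.I))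
  rw [h1, h2] at this
  simp only [Complex.norm_ofNat]
  linarith

theorem norm_sin_le (z : ℂ) : ‖Complex.sin z‖ ≤ Real.cosh z.im := by
  rw [Complex.sin, norm_div, norm_mul, Complex.norm_I, mul_one, Real.cosh_eq]
  have h1 : ‖Complex.exp (z * Complex.I)‖ = Real.exp (-z.im) := by simp [Complex.norm_exp]
  have h2 : ‖Complex.exp (-z * Complex.I)‖ = Real.exp z.im := by simp [Complex.norm_exp]
  have := norm_sub_le (Complex.exp (-z * Complex.I)) (Complex.exp (z * Complex.I))
  rw [h1, h2] at this
  simp only [Complex.norm_ofNat]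
  linarith

theorem cosh_mul_im_le {C : ℝ} {ω : ℂ} (hω : |ω.im| ≤ C) (t : ℝ) :
    Real.cosh (ω * (t : ℂ)).im ≤ Real.cosh (C * t) := by
  have : (ω * (t : ℂ)).im = ω.im * t := by simp
  rw [this, Real.cosh_le_cosh, abs_mul, abs_mul]
  exact mul_le_mul_of_nonneg_right (hω.trans (le_abs_self C)) (abs_nonneg t)

theorem norm_cos_mul_le {C : ℝ} {ω : ℂ} (hω : |ω.im| ≤ C) (t : ℝ) :
    ‖Complex.cos (ω * (t : ℂ))‖ ≤ Real.cosh (C * t) :=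
  (norm_cos_le _).trans (cosh_mul_im_le hω t)

theorem norm_sin_mul_le {C : ℝ} {ω : ℂ} (hω : |ω.im| ≤ C) (t : ℝ) :
    ‖Complex.sin (ω * (t : ℂ))‖ ≤ Real.cosh (C * t) :=
  (norm_sin_le _).trans (cosh_mul_im_le hω t)

/-- Writing sin(ωx)/ω as ∫_0^x cos ωt dt gives a bound that does not degenerate as ω → 0. -/
theorem norm_sin_mul_div_le {C : ℝ} {ω : ℂ} (h0 : ω ≠ 0) (hω : |ω.im| ≤ C) {x : ℝ} (hx : 0 ≤ x) :
    ‖Complex.sin (ω * (x : ℂ)) / ω‖ ≤ sinhDiv C x := by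
  have h := integral_cos_mul_complex h0 0 x
  simp only [Complex.ofReal_zero, mul_zero, Complex.sin_zero, zero_div, sub_zero] at h
  rw [← h, ← integral_cosh_mul]
  refine intervalIntegral.norm_integral_le_of_norm_le hx ?_ ?_
  · exact Eventually.of_forall fun t _ => norm_cos_mul_le hω t
  · exact (by fun_prop : Continuous fun t => Real.cosh (C * t)).intervalIntegrable _ _

theorem hasDerivAt_cos_mul (ω : ℂ) (x : ℝ) :
    HasDerivAt (fun t : ℝ => Complex.cos (ω * (t : ℂ))) (-ω * Complex.sin (ω * (x : ℂ))) x := by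
  have h := ((hasDerivAt_id (x : ℂ)).const_mul ω).ccos.comp_ofReal
  convert! h using 1
  simp [mul_comm]

theorem hasDerivAt_sin_mul (ω : ℂ) (x : ℝ) :
    HasDerivAt (fun t : ℝ => Complex.sin (ω * (t : ℂ))) (ω * Complex.cos (ω * (x : ℂ))) x := by
  have h := ((hasDerivAt_id (x : ℂ)).const_mul ω).csin.comp_ofReal
  convert! h using 1
  simp [mul_comm]

/-! ### An integral inequality -/

/-- A Grönwall inequality for the kernel `sinh (C (x - s)) / C`. -/
theorem le_of_le_integral_sinhDiv {b C K M : ℝ} (hC : 0 ≤ C) (hK : 0 ≤ K) (hM : 0 ≤ M)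
    {z : ℝ → ℝ} (hz : ContinuousOn z (Ico 0 b)) (hz0 : ∀ x ∈ Ico 0 b, 0 ≤ z x)
    (h : ∀ x ∈ Ico 0 b, z x ≤ K * sinhDiv C x + M * ∫ s in (0 : ℝ)..x, sinhDiv C (x - s) * z s) :
    ∀ x ∈ Ico 0 b, z x ≤ K * Real.exp (M * b ^ 2) * sinhDiv C x := by
  intro x hx
  have hcosh : ∀ s : ℝ, 0 < Real.cosh (C * s) := fun s => Real.cosh_pos _
  have hzc : ContinuousOn (fun s => z s / Real.cosh (C * s)) (Ico 0 b) :=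
    hz.div (by fun_prop) fun s _ => (hcosh s).ne'
  have hsub : ∀ y ∈ Icc 0 x, Icc 0 y ⊆ Ico 0 b := fun y hy s hs =>
    ⟨hs.1, (hs.2.trans hy.2).trans_lt hx.2⟩
  -- Since sinh(C(y - s))/C ≤ (sinh(Cy)/C) / cosh(Cs), the hypothesis yields z ≤ (sinh(Cy)/C) R.
  -- Then R' = M z / cosh(Cy) ≤ M y R ≤ M b R, and the ordinary Grönwall inequality applies to R.
  set R : ℝ → ℝ := fun y => K + M * ∫ s in (0 : ℝ)..y, z s / Real.cosh (C * s) with hR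
  have hRz : ∀ y ∈ Icc 0 x, z y ≤ sinhDiv C y * R y := by
    intro y hy
    have hyb : y ∈ Ico 0 b := ⟨hy.1, hy.2.trans_lt hx.2⟩
    refine (h y hyb).trans ?_
    have hsd : Continuous (fun s => sinhDiv C (y - s)) :=
      (continuous_sinhDiv C).comp (by fun_prop)
    have : ∫ s in (0 : ℝ)..y, sinhDiv C (y - s) * z s ≤
        ∫ s in (0 : ℝ)..y, sinhDiv C y * (z s / Real.cosh (C * s)) := by
      refine intervalIntegral.integral_mono_on hy.1 ?_ ?_ ?_
      · refine ContinuousOn.intervalIntegrable ?_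
        rw [uIcc_of_le hy.1]
        exact hsd.continuousOn.mul (hz.mono (hsub y hy))
      · refine ContinuousOn.intervalIntegrable ?_
        rw [uIcc_of_le hy.1]
        exact continuousOn_const.mul (hzc.mono (hsub y hy))
      · intro s hs
        rw [mul_div_assoc', le_div_iff₀ (hcosh s)]
        have h1 := sinhDiv_sub_mul_cosh_le (x := y) hC hs.1
        have h2 := hz0 s (hsub y hy hs)
        nlinarith
    rw [intervalIntegral.integral_const_mul] at this
    have := mul_le_mul_of_nonneg_left this hM
    simp only [hR]
    linarith
  have hRn : ∀ y ∈ Icc 0 x, 0 ≤ R y := by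
    intro y hy
    refine add_nonneg hK (mul_nonneg hM (intervalIntegral.integral_nonneg hy.1 fun s hs => ?_))
    exact div_nonneg (hz0 s (hsub y hy hs)) (hcosh s).le
  have hRd : ∀ y ∈ Ico 0 x, HasDerivWithinAt R (M * (z y / Real.cosh (C * y))) (Ici y) y := by
    intro y hy
    have hyx : y ∈ Icc 0 x := ⟨hy.1, hy.2.le⟩
    refine HasDerivWithinAt.const_add K (HasDerivWithinAt.const_mul M ?_)
    have hcy : ContinuousOn (fun s => z s / Real.cosh (C * s)) (Ico y b) :=
      hzc.mono (Ico_subset_Ico_left hy.1)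
    have hmem : Ico y b ∈ 𝓝[>] y :=
      mem_of_superset (Ioo_mem_nhdsGT (hy.2.trans hx.2)) Ioo_subset_Ico_self
    refine intervalIntegral.integral_hasDerivWithinAt_right ?_ (t := Ioi y)
      ⟨Ico y b, hmem, hcy.aestronglyMeasurable measurableSet_Ico⟩
      ((hcy y ⟨le_rfl, hy.2.trans hx.2⟩).mono_of_mem_nhdsWithin hmem)
    refine ContinuousOn.intervalIntegrable ?_
    rw [uIcc_of_le hy.1]
    exact hzc.mono (hsub y hyx)
  have hRc : ContinuousOn R (Icc 0 x) := by
    refine continuousOn_const.add (continuousOn_const.mul ?_)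
    have := intervalIntegral.continuousOn_primitive_interval (μ := volume) (a := 0) (b := x)
      (f := fun s => z s / Real.cosh (C * s))
    rw [uIcc_of_le hx.1] at this
    exact this ((hzc.mono (hsub x ⟨hx.1, le_rfl⟩)).integrableOn_Icc)
  have hb : 0 ≤ b := hx.1.trans hx.2.le
  have key := norm_le_gronwallBound_of_norm_deriv_right_le (K := M * b) (δ := K) (ε := 0) hRc hRd
    (by simp [hR, abs_of_nonneg hK]) (by
      intro y hy
      have hyx : y ∈ Icc 0 x := ⟨hy.1, hy.2.le⟩
      have hz1 := hz0 y (hsub y hyx ⟨hy.1, le_rfl⟩)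
      rw [Real.norm_of_nonneg (mul_nonneg hM (div_nonneg hz1 (hcosh y).le)),
        Real.norm_of_nonneg (hRn y hyx), add_zero, mul_assoc]
      refine mul_le_mul_of_nonneg_left ?_ hM
      rw [div_le_iff₀ (hcosh y)]
      refine (hRz y hyx).trans ?_
      have h1 := (sinhDiv_le_mul_cosh C hy.1).trans
        (mul_le_mul_of_nonneg_right (hy.2.le.trans hx.2.le) (hcosh y).le)
      have := mul_le_mul_of_nonneg_right h1 (hRn y hyx)
      linarith) x ⟨hx.1, le_rfl⟩
  have hx' : x ∈ Icc 0 x := ⟨hx.1, le_rfl⟩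
  rw [gronwallBound_ε0, Real.norm_of_nonneg (hRn x hx'), sub_zero] at key
  refine (hRz x hx').trans ?_
  rw [mul_comm]
  refine mul_le_mul_of_nonneg_right (key.trans ?_) (sinhDiv_nonneg C hx.1)
  refine mul_le_mul_of_nonneg_left (Real.exp_le_exp.2 ?_) hK
  have : M * b * x ≤ M * b * b := mul_le_mul_of_nonneg_left hx.2.le (mul_nonneg hM hb)
  linarith [this, sq b, mul_assoc M b b]

/-! ### Stability of the residual equation -/

/-- If `e'' = (Q - ω²) e - 4 D' c` with `e(0) = 0` and `e'(0) = -2 D(0) c(0)`, then `e` is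
controlled by the size of `D`, although `D'` enters the equation. -/
theorem norm_le_of_residual_right {b C M ε : ℝ} {ω : ℂ} (hC : 0 ≤ C) (h0 : ω ≠ 0)
    (hω : |ω.im| ≤ C) (hM : 0 ≤ M) {Q e e' D D' c d d' : ℝ → ℂ}
    (hQ : ContinuousOn Q (Ico 0 b)) (hQM : ∀ x ∈ Ico 0 b, ‖Q x‖ ≤ M)
    (he : ∀ x ∈ Ico 0 b, HasDerivAt e (e' x) x)
    (he' : ∀ x ∈ Ico 0 b, HasDerivAt e' ((Q x - ω ^ 2) * e x - 4 * D' x * c x) x)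
    (hD : ∀ x ∈ Ico 0 b, HasDerivAt D (D' x) x)
    (hc : ∀ x, HasDerivAt c (d x) x) (hd : ∀ x, HasDerivAt d (d' x) x)
    (he0 : e 0 = 0) (he'0 : e' 0 = -2 * D 0 * c 0) (hc0 : ‖c 0‖ ≤ 1)
    (hcd : ∀ x s : ℝ, ‖Complex.sin (ω * ((x - s : ℝ) : ℂ)) / ω * d s -
      Complex.cos (ω * ((x - s : ℝ) : ℂ)) * c s‖ ≤ Real.cosh (C * (x - 2 * s)))
    (hDε : ∀ x ∈ Ico 0 b, ‖D x‖ ≤ ε) :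
    ∀ x ∈ Ico 0 b, ‖e x‖ ≤ 6 * ε * Real.exp (M * b ^ 2) * sinhDiv C x := by
  have hecont : ContinuousOn e (Ico 0 b) := fun x hx => (he x hx).continuousAt.continuousWithinAt
  have hDcont : ContinuousOn D (Ico 0 b) := fun x hx => (hD x hx).continuousAt.continuousWithinAt
  have hccont : Continuous c := continuous_iff_continuousAt.2 fun x => (hc x).continuousAt
  have hdcont : Continuous d := continuous_iff_continuousAt.2 fun x => (hd x).continuousAt
  intro x₀ hx₀
  have hε : 0 ≤ ε := (norm_nonneg _).trans (hDε x₀ hx₀)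
  refine le_of_le_integral_sinhDiv (z := fun x => ‖e x‖) hC (by positivity) hM hecont.norm
    (fun x _ => norm_nonneg _) ?_ x₀ hx₀
  intro x hx
  have hsub : Icc 0 x ⊆ Ico 0 b := fun s hs => ⟨hs.1, hs.2.trans_lt hx.2⟩
  have huIcc : uIcc 0 x = Icc 0 x := uIcc_of_le hx.1
  -- Duhamel kernels: as functions of s, both solve the oscillator equation, with S = 0 and K = 1 at
  -- s = x.
  set S : ℝ → ℂ := fun s => Complex.sin (ω * ((x - s : ℝ) : ℂ)) / ω with hS
  set K : ℝ → ℂ := fun s => Complex.cos (ω * ((x - s : ℝ) : ℂ)) with hK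
  have hSd : ∀ s, HasDerivAt S (-K s) s := by
    intro s
    have h := ((hasDerivAt_sin_mul ω (x - s)).comp_const_sub x s).div_const ω
    convert! h using 1
    simp only [hK]
    field_simp
  have hKd : ∀ s, HasDerivAt K (ω ^ 2 * S s) s := by
    intro s
    have h := (hasDerivAt_cos_mul ω (x - s)).comp_const_sub x s
    convert! h using 1
    simp only [hS]
    field_simp
  have hScont : Continuous S := continuous_iff_continuousAt.2 fun s => (hSd s).continuousAt
  have hKcont : Continuous K := continuous_iff_continuousAt.2 fun s => (hKd s).continuousAt
  have hQc := hQ.mono hsub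
  have hec := hecont.mono hsub
  have hDc := hDcont.mono hsub
  have hint1 : IntervalIntegrable (fun s => S s * Q s * e s) volume 0 x := by
    refine ContinuousOn.intervalIntegrable ?_
    rw [huIcc]
    exact (hScont.continuousOn.mul hQc).mul hec
  have hint2 : IntervalIntegrable (fun s => 4 * D s * (S s * d s - K s * c s)) volume 0 x := by
    refine ContinuousOn.intervalIntegrable ?_
    rw [huIcc]
    exact (continuousOn_const.mul hDc).mul
      ((hScont.mul hdcont).sub (hKcont.mul hccont)).continuousOn
  -- In the derivative of K e + S e' the ω² terms cancel, leaving S Q e - 4 S D' c. Adding 4 S D c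
  -- to the antiderivative cancels D' and leaves D (S c)'.
  have key : ∫ s in (0 : ℝ)..x, (S s * Q s * e s + 4 * D s * (S s * d s - K s * c s)) =
      (K x * e x + S x * e' x + 4 * (S x * (D x * c x))) -
      (K 0 * e 0 + S 0 * e' 0 + 4 * (S 0 * (D 0 * c 0))) := by
    refine intervalIntegral.integral_eq_sub_of_hasDerivAt
      (f := fun s => K s * e s + S s * e' s + 4 * (S s * (D s * c s))) ?_ (hint1.add hint2)
    intro s hs
    have hs' := hsub (huIcc ▸ hs)
    have h := (((hKd s).mul (he s hs')).add ((hSd s).mul (he' s hs'))).add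
      (((hSd s).mul ((hD s hs').mul (hc s))).const_mul 4)
    convert! h using 1
    simp only [Pi.mul_apply]
    ring
  have hKx : K x = 1 := by simp [hK]
  have hSx : S x = 0 := by simp [hS]
  rw [hKx, hSx, he0, he'0, intervalIntegral.integral_add hint1 hint2] at key
  have hex : e x = 2 * S 0 * D 0 * c 0 + (∫ s in (0 : ℝ)..x, S s * Q s * e s) +
      ∫ s in (0 : ℝ)..x, 4 * D s * (S s * d s - K s * c s) := by
    linear_combination -key
  have hSn : ∀ s ∈ Icc 0 x, ‖S s‖ ≤ sinhDiv C (x - s) := fun s hs =>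
    norm_sin_mul_div_le h0 hω (sub_nonneg.2 hs.2)
  -- The coefficient 2 is 4 from the integration by parts minus 2 from e'(0). With the 4ε of `hb3`
  -- it gives the constant 6.
  have hb1 : ‖2 * S 0 * D 0 * c 0‖ ≤ 2 * ε * sinhDiv C x := by
    have h1 := hSn 0 ⟨le_rfl, hx.1⟩
    rw [sub_zero] at h1
    have h2 := hDε 0 ⟨le_rfl, hx.1.trans_lt hx.2⟩
    have h3 := sinhDiv_nonneg C hx.1
    rw [norm_mul, norm_mul, norm_mul, Complex.norm_ofNat]
    calc 2 * ‖S 0‖ * ‖D 0‖ * ‖c 0‖ ≤ 2 * sinhDiv C x * ε * 1 := by gcongr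
      _ = _ := by ring
  have hb2 : ‖∫ s in (0 : ℝ)..x, S s * Q s * e s‖ ≤
      M * ∫ s in (0 : ℝ)..x, sinhDiv C (x - s) * ‖e s‖ := by
    rw [← intervalIntegral.integral_const_mul]
    refine intervalIntegral.norm_integral_le_of_norm_le hx.1 ?_ ?_
    · refine Eventually.of_forall fun s hs => ?_
      have hs' := Ioc_subset_Icc_self hs
      rw [norm_mul, norm_mul]
      calc ‖S s‖ * ‖Q s‖ * ‖e s‖ ≤ sinhDiv C (x - s) * M * ‖e s‖ := by
            gcongr
            · exact sinhDiv_nonneg C (sub_nonneg.2 hs'.2)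
            · exact hSn s hs'
            · exact hQM s (hsub hs')
        _ = _ := by ring
    · refine ContinuousOn.intervalIntegrable ?_
      rw [huIcc]
      have : Continuous fun s => sinhDiv C (x - s) := (continuous_sinhDiv C).comp (by fun_prop)
      exact continuousOn_const.mul (this.continuousOn.mul hec.norm)
  -- Bounding S d and K c separately would give cosh(C(x - s)) cosh(Cs), whose integral contains x
  -- cosh(Cx) and is not O(sinh(Cx)/C) uniformly in C. The combined bound `hcd` avoids this loss.
  have hb3 : ‖∫ s in (0 : ℝ)..x, 4 * D s * (S s * d s - K s * c s)‖ ≤ 4 * ε * sinhDiv C x := by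
    rw [← integral_cosh_mul_sub, ← intervalIntegral.integral_const_mul]
    refine intervalIntegral.norm_integral_le_of_norm_le hx.1 ?_ ?_
    · refine Eventually.of_forall fun s hs => ?_
      rw [norm_mul, norm_mul, Complex.norm_ofNat]
      have h1 := hDε s (hsub (Ioc_subset_Icc_self hs))
      have h2 := hcd x s
      gcongr
    · exact (by fun_prop : Continuous fun s =>
        4 * ε * Real.cosh (C * (x - 2 * s))).intervalIntegrable _ _
  rw [hex]
  refine (norm_add₃_le).trans ?_
  linarith

/-- The two-sided form of `norm_le_of_residual_right`. -/
theorem norm_le_of_residual {b C M ε : ℝ} {ω : ℂ} (hC : 0 ≤ C) (h0 : ω ≠ 0)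
    (hω : |ω.im| ≤ C) (hM : 0 ≤ M) {Q e e' D D' c d d' : ℝ → ℂ}
    (hQ : ContinuousOn Q (Ioo (-b) b)) (hQM : ∀ x ∈ Ioo (-b) b, ‖Q x‖ ≤ M)
    (he : ∀ x ∈ Ioo (-b) b, HasDerivAt e (e' x) x)
    (he' : ∀ x ∈ Ioo (-b) b, HasDerivAt e' ((Q x - ω ^ 2) * e x - 4 * D' x * c x) x)
    (hD : ∀ x ∈ Ioo (-b) b, HasDerivAt D (D' x) x)
    (hc : ∀ x, HasDerivAt c (d x) x) (hd : ∀ x, HasDerivAt d (d' x) x)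
    (he0 : e 0 = 0) (he'0 : e' 0 = -2 * D 0 * c 0) (hc0 : ‖c 0‖ ≤ 1)
    (hcd : ∀ x s : ℝ, ‖Complex.sin (ω * ((x - s : ℝ) : ℂ)) / ω * d s -
      Complex.cos (ω * ((x - s : ℝ) : ℂ)) * c s‖ ≤ Real.cosh (C * (x - 2 * s)))
    (hDε : ∀ x ∈ Ioo (-b) b, ‖D x‖ ≤ ε) :
    ∀ x ∈ Ioo (-b) b, ‖e x‖ ≤ 6 * ε * Real.exp (M * b ^ 2) * sinhDiv C b := by
  intro x hx
  have hb : 0 < b := by linarith [hx.1, hx.2]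
  have hε : 0 ≤ ε := (norm_nonneg _).trans (hDε x hx)
  have hmono : ∀ y ∈ Ico 0 b, 6 * ε * Real.exp (M * b ^ 2) * sinhDiv C y ≤
      6 * ε * Real.exp (M * b ^ 2) * sinhDiv C b := fun y hy => by
    have := sinhDiv_mono C hy.2.le
    gcongr
  rcases le_total 0 x with hx0 | hx0
  · have hsub : Ico 0 b ⊆ Ioo (-b) b := fun y hy => ⟨by linarith [hy.1], hy.2⟩
    refine (norm_le_of_residual_right hC h0 hω hM (hQ.mono hsub) (fun y hy => hQM y (hsub hy))
      (fun y hy => he y (hsub hy)) (fun y hy => he' y (hsub hy)) (fun y hy => hD y (hsub hy))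
      hc hd he0 he'0 hc0 hcd (fun y hy => hDε y (hsub hy)) x ⟨hx0, hx.2⟩).trans
      (hmono x ⟨hx0, hx.2⟩)
  · have hneg : ∀ y ∈ Ico 0 b, -y ∈ Ioo (-b) b := fun y hy =>
      ⟨by linarith [hy.2], by linarith [hy.1]⟩
    have hx' : -x ∈ Ico 0 b := ⟨by linarith, by linarith [hx.1]⟩
    have comp : ∀ {f f' : ℝ → ℂ} {y : ℝ}, HasDerivAt f (f' (-y)) (-y) →
        HasDerivAt (fun t => f (-t)) (-f' (-y)) y := by
      intro f f' y h
      convert! h.scomp y (hasDerivAt_neg y) using 1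
      simp
    have comp_neg : ∀ {f f' : ℝ → ℂ} {y : ℝ}, HasDerivAt f (f' (-y)) (-y) →
        HasDerivAt (fun t => -f (-t)) (f' (-y)) y := by
      intro f f' y h
      convert! (comp h).neg using 1
      simp
    -- Reflection x ↦ -x. Replacing D by -D(-x) leaves D' evaluated at -x without a sign change, so
    -- the residual equation keeps its form; the initial condition is kept because e' and D both
    -- change sign.
    have h := norm_le_of_residual_right (Q := fun y => Q (-y)) (e := fun y => e (-y))
      (e' := fun y => -e' (-y)) (D := fun y => -D (-y)) (D' := fun y => D' (-y))
      (c := fun y => c (-y)) (d := fun y => -d (-y)) (d' := fun y => d' (-y)) (ε := ε)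
      hC h0 hω hM (hQ.comp continuous_neg.continuousOn hneg) (fun y hy => hQM _ (hneg y hy))
      (fun y hy => comp (he _ (hneg y hy)))
      (fun y hy => comp_neg (f' := fun y => (Q y - ω ^ 2) * e y - 4 * D' y * c y)
        (he' _ (hneg y hy)))
      (fun y hy => comp_neg (hD _ (hneg y hy)))
      (fun y => comp (hc _)) (fun y => comp_neg (hd _))
      (by simpa using he0) (by simp [he'0]) (by simpa using hc0)
      (fun y s => by
        have h := hcd (-y) (-s)
        have e1 : (-y - -s : ℝ) = -(y - s) := by ring
        have e2 : C * (-y - 2 * -s) = -(C * (y - 2 * s)) := by ring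
        rw [e1, e2, Real.cosh_neg, Complex.ofReal_neg, mul_neg, Complex.sin_neg,
          Complex.cos_neg] at h
        convert! h using 2
        ring)
      (fun y hy => by simpa using hDε _ (hneg y hy)) (-x) hx'
    simp only [neg_neg] at h
    exact h.trans (hmono _ hx')

/-! ### Generalized wave polynomials -/

theorem hasDerivAt_integral_of_continuous {f : ℝ → ℂ} (hf : Continuous f) (x₀ x : ℝ) :
    HasDerivAt (fun u => ∫ t in x₀..u, f t) (f x) x :=
  intervalIntegral.integral_hasDerivAt_right (hf.intervalIntegrable _ _)
    hf.aestronglyMeasurable.stronglyMeasurableAtFilter hf.continuousAt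

theorem hasDerivAt_ofReal_pow (k : ℕ) (x : ℝ) :
    HasDerivAt (fun t : ℝ => (t : ℂ) ^ k) (k * (x : ℂ) ^ (k - 1)) x := by
  simpa using (hasDerivAt_pow k (x : ℂ)).comp_ofReal

/-- Two integrations by parts against a solution of `c'' = -ω² c`. -/
theorem integral_pow_mul_of_oscillator {ω : ℂ} {c d : ℝ → ℂ} (hc : ∀ x, HasDerivAt c (d x) x)
    (hd : ∀ x, HasDerivAt d (-ω ^ 2 * c x) x) (k : ℕ) (hd0 : k = 0 → d 0 = 0)
    (hc0 : k = 1 → c 0 = 0) (x : ℝ) :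
    (k : ℂ) * ((k : ℂ) - 1) * ∫ t in (0 : ℝ)..x, (t : ℂ) ^ (k - 2) * c t =
      k * (x : ℂ) ^ (k - 1) * c x - (x : ℂ) ^ k * d x -
        ω ^ 2 * ∫ t in (0 : ℝ)..x, (t : ℂ) ^ k * c t := by
  have hcc : Continuous c := continuous_iff_continuousAt.2 fun x => (hc x).continuousAt
  have hint : ∀ j : ℕ, Continuous fun t : ℝ => (t : ℂ) ^ j * c t := fun j => by fun_prop
  have key : ∫ t in (0 : ℝ)..x, ((k : ℂ) * ((k : ℂ) - 1) * ((t : ℂ) ^ (k - 2) * c t) +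
      ω ^ 2 * ((t : ℂ) ^ k * c t)) =
      (k * (x : ℂ) ^ (k - 1) * c x - (x : ℂ) ^ k * d x) -
      (k * ((0 : ℝ) : ℂ) ^ (k - 1) * c 0 - ((0 : ℝ) : ℂ) ^ k * d 0) := by
    refine intervalIntegral.integral_eq_sub_of_hasDerivAt
      (f := fun t : ℝ => k * (t : ℂ) ^ (k - 1) * c t - (t : ℂ) ^ k * d t) ?_
      ((((hint _).const_mul _).add ((hint _).const_mul _)).intervalIntegrable _ _)
    intro t _
    have h := ((((hasDerivAt_ofReal_pow (k - 1) t).const_mul (k : ℂ)).fun_mul (hc t))).fun_sub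
      ((hasDerivAt_ofReal_pow k t).fun_mul (hd t))
    convert! h using 1
    rcases k with _ | k
    · simp
    · simp only [Nat.add_sub_cancel, show k + 1 - 2 = k - 1 from by omega]
      push_cast
      ring
  -- The powers of t kill the boundary terms at 0 except d(0) when k = 0 and c(0) when k = 1. Even k
  -- is paired with cosine and odd k with sine so that these vanish too.
  have h0 : k * ((0 : ℝ) : ℂ) ^ (k - 1) * c 0 - ((0 : ℝ) : ℂ) ^ k * d 0 = 0 := by
    rcases k with _ | _ | k
    · simp [hd0 rfl]
    · simp [hc0 rfl]
    · simp
  rw [h0, sub_zero, intervalIntegral.integral_add (((hint _).const_mul _).intervalIntegrable _ _)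
    (((hint _).const_mul _).intervalIntegrable _ _), intervalIntegral.integral_const_mul,
    intervalIntegral.integral_const_mul] at key
  linear_combination key

/-- Shifting the index by two in a binomial sum over indices of a fixed parity. -/
theorem sum_choose_shift_two (P : ℕ → Prop) [DecidablePred P] (hP : ∀ k, P (k + 2) ↔ P k) (n : ℕ)
    (φ J : ℕ → ℂ) :
    ∑ k ∈ (Finset.range (n + 1)).filter (fun k => P k), (n.choose k : ℂ) *
        (((n - k : ℕ) : ℂ) * (((n - k : ℕ) : ℂ) - 1) * φ (n - k - 2)) * J k =
      ∑ k ∈ (Finset.range (n + 1)).filter (fun k => P k), (n.choose k : ℂ) * φ (n - k) *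
        ((k : ℂ) * ((k : ℂ) - 1) * J (k - 2)) := by
  rw [Finset.sum_filter, Finset.sum_filter]
  rcases n with _ | _ | n
  · simp
  · simp [Finset.sum_range_succ]
  -- On the left the two top indices vanish because of (n - k)(n - k - 1), on the right the two
  -- bottom ones because of k (k - 1). The remaining terms match under k ↦ k + 2, where binom(n,
  -- k)(n - k)(n - k - 1) = binom(n, k + 2)(k + 2)(k + 1).
  · rw [Finset.sum_range_succ, Finset.sum_range_succ, Finset.sum_range_succ' _ (n + 2),
      Finset.sum_range_succ' _ (n + 1)]
    have e1 : n + 1 + 1 - (n + 1) = 1 := by omega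
    simp only [e1, Nat.sub_self]
    simp only [Nat.cast_zero, Nat.cast_one, zero_mul, mul_zero, sub_self, ite_self, add_zero,
      zero_add]
    refine Finset.sum_congr rfl fun k hk => ?_
    rw [show k + 1 + 1 = k + 2 from rfl]
    simp only [hP]
    split_ifs with h
    · have hk' : k ≤ n := Nat.lt_succ_iff.1 (Finset.mem_range.1 hk)
      obtain ⟨j, rfl⟩ := Nat.exists_eq_add_of_le hk'
      have e2 : k + j + 1 + 1 - k = j + 2 := by omega
      have e3 : k + j + 1 + 1 - (k + 2) = j := by omega
      simp only [e2, e3, Nat.add_sub_cancel]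
      have h1 : ((k + j + 2).choose (k + 1) : ℂ) * ((k : ℂ) + 1) =
          ((k + j + 2).choose k : ℂ) * ((j : ℂ) + 2) := by
        have := Nat.choose_succ_right_eq (k + j + 2) k
        rw [show k + j + 2 - k = j + 2 from by omega] at this
        exact_mod_cast this
      have h2 : ((k + j + 2).choose (k + 2) : ℂ) * ((k : ℂ) + 2) =
          ((k + j + 2).choose (k + 1) : ℂ) * ((j : ℂ) + 1) := by
        have := Nat.choose_succ_right_eq (k + j + 2) (k + 1)
        rw [show k + j + 2 - (k + 1) = j + 1 from by omega] at this
        exact_mod_cast this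
      rw [show k + j + 1 + 1 = k + j + 2 from rfl]
      push_cast
      linear_combination (-(φ j * J k * ((j : ℂ) + 1))) * h1 - (φ j * J k * ((k : ℂ) + 1)) * h2
    · rfl

/-- The generalized wave polynomial `∑ binom(n, k) φ_{n-k}(x) t^k`, the sum over the `k` with
`P k`, on the characteristic `t = x`. -/
def waveTrace (P : ℕ → Prop) [DecidablePred P] (φ : ℕ → ℝ → ℂ) (n : ℕ) (x : ℝ) : ℂ :=
  ∑ k ∈ (Finset.range (n + 1)).filter (fun k => P k), (n.choose k : ℂ) * (x : ℂ) ^ k * φ (n - k) x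

/-- The integral of a generalized wave polynomial against `c`. -/
noncomputable def waveIntegral (P : ℕ → Prop) [DecidablePred P] (φ : ℕ → ℝ → ℂ) (c : ℝ → ℂ) (n : ℕ) (x : ℝ) : ℂ :=
  ∑ k ∈ (Finset.range (n + 1)).filter (fun k => P k), (n.choose k : ℂ) * φ (n - k) x *
    ∫ t in (0 : ℝ)..x, (t : ℂ) ^ k * c t

/-- The derivative of `waveTrace`, given the derivatives `ψ` of `φ`. -/
def waveTrace' (P : ℕ → Prop) [DecidablePred P] (φ ψ : ℕ → ℝ → ℂ) (n : ℕ) (x : ℝ) : ℂ :=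
  ∑ k ∈ (Finset.range (n + 1)).filter (fun k => P k), (n.choose k : ℂ) *
    (k * (x : ℂ) ^ (k - 1) * φ (n - k) x + (x : ℂ) ^ k * ψ (n - k) x)

/-- The derivative of `waveIntegral`, given the derivatives `ψ` of `φ`. -/
noncomputable def waveIntegral' (P : ℕ → Prop) [DecidablePred P] (φ ψ : ℕ → ℝ → ℂ) (c : ℝ → ℂ) (n : ℕ)
    (x : ℝ) : ℂ :=
  ∑ k ∈ (Finset.range (n + 1)).filter (fun k => P k), (n.choose k : ℂ) *
    (ψ (n - k) x * (∫ t in (0 : ℝ)..x, (t : ℂ) ^ k * c t) + φ (n - k) x * ((x : ℂ) ^ k * c x))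

section Wave

variable {P : ℕ → Prop} [DecidablePred P] {φ ψ : ℕ → ℝ → ℂ} {c d : ℝ → ℂ} {x : ℝ}

theorem hasDerivAt_waveTrace (hφ : ∀ k, HasDerivAt (φ k) (ψ k x) x) (n : ℕ) :
    HasDerivAt (waveTrace P φ n) (waveTrace' P φ ψ n x) x := by
  refine HasDerivAt.fun_sum fun k _ => ?_
  have h := ((hasDerivAt_ofReal_pow k x).fun_mul (hφ (n - k))).const_mul (n.choose k : ℂ)
  convert! h using 1
  ext t
  ring

theorem hasDerivAt_waveIntegral (hφ : ∀ k, HasDerivAt (φ k) (ψ k x) x) (hc : Continuous c) (n : ℕ) :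
    HasDerivAt (waveIntegral P φ c n) (waveIntegral' P φ ψ c n x) x := by
  refine HasDerivAt.fun_sum fun k _ => ?_
  have h := ((hφ (n - k)).fun_mul (hasDerivAt_integral_of_continuous
    (f := fun t : ℝ => (t : ℂ) ^ k * c t) (by fun_prop) 0 x)).const_mul (n.choose k : ℂ)
  convert! h using 1
  ext t
  ring

/-- Differentiation under the integral turns u_xx into Q u + u_tt, and two integrations by parts in
t move u_tt onto c, producing -ω². The d(x) boundary terms cancel; the others assemble into twice
the derivative of the trace on t = x. -/
theorem hasDerivAt_waveIntegral' {Q : ℝ → ℂ} {ω : ℂ} (hP : ∀ k, P (k + 2) ↔ P k)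
    (hd0 : P 0 → d 0 = 0) (hc0 : P 1 → c 0 = 0)
    (hφ : ∀ k, HasDerivAt (φ k) (ψ k x) x)
    (hψ : ∀ k : ℕ, HasDerivAt (ψ k) (Q x * φ k x + k * ((k : ℂ) - 1) * φ (k - 2) x) x)
    (hc : ∀ x, HasDerivAt c (d x) x) (hd : ∀ x, HasDerivAt d (-ω ^ 2 * c x) x) (n : ℕ) :
    HasDerivAt (waveIntegral' P φ ψ c n)
      ((Q x - ω ^ 2) * waveIntegral P φ c n x + 2 * waveTrace' P φ ψ n x * c x) x := by
  have hcc : Continuous c := continuous_iff_continuousAt.2 fun x => (hc x).continuousAt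
  have key : HasDerivAt (waveIntegral' P φ ψ c n)
      (∑ k ∈ (Finset.range (n + 1)).filter (fun k => P k), (n.choose k : ℂ) *
        (((Q x * φ (n - k) x + (n - k : ℕ) * (((n - k : ℕ) : ℂ) - 1) * φ (n - k - 2) x) *
          (∫ t in (0 : ℝ)..x, (t : ℂ) ^ k * c t) + ψ (n - k) x * ((x : ℂ) ^ k * c x)) +
        (ψ (n - k) x * ((x : ℂ) ^ k * c x) +
          φ (n - k) x * (k * (x : ℂ) ^ (k - 1) * c x + (x : ℂ) ^ k * d x)))) x := by
    refine HasDerivAt.fun_sum fun k _ => ?_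
    exact (((hψ (n - k)).fun_mul (hasDerivAt_integral_of_continuous
      (f := fun t : ℝ => (t : ℂ) ^ k * c t) (by fun_prop) 0 x)).fun_add
      ((hφ (n - k)).fun_mul ((hasDerivAt_ofReal_pow k x).fun_mul (hc x)))).const_mul _
  convert! key using 1
  -- The wave equation at the level of coefficients: lowering the index of φ by two is the same as
  -- differentiating t^k twice.
  have hshift := sum_choose_shift_two P hP n (fun k => φ k x)
    (fun k => ∫ t in (0 : ℝ)..x, (t : ℂ) ^ k * c t)
  have hibp : ∑ k ∈ (Finset.range (n + 1)).filter (fun k => P k), (n.choose k : ℂ) * φ (n - k) x *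
        ((k : ℂ) * ((k : ℂ) - 1) * ∫ t in (0 : ℝ)..x, (t : ℂ) ^ (k - 2) * c t) =
      ∑ k ∈ (Finset.range (n + 1)).filter (fun k => P k), (n.choose k : ℂ) * φ (n - k) x *
        (k * (x : ℂ) ^ (k - 1) * c x - (x : ℂ) ^ k * d x -
          ω ^ 2 * ∫ t in (0 : ℝ)..x, (t : ℂ) ^ k * c t) := by
    refine Finset.sum_congr rfl fun k hk => ?_
    have hPk := (Finset.mem_filter.1 hk).2
    rw [integral_pow_mul_of_oscillator hc hd k (fun h => hd0 (h ▸ hPk)) (fun h => hc0 (h ▸ hPk))]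
  have htot := hshift.trans hibp
  rw [← sub_eq_zero, ← Finset.sum_sub_distrib] at htot
  rw [← sub_eq_zero, ← neg_eq_zero]
  rw [← htot]
  simp only [waveIntegral, waveTrace', Finset.mul_sum, Finset.sum_mul]
  rw [← Finset.sum_add_distrib, ← Finset.sum_sub_distrib, ← Finset.sum_neg_distrib]
  refine Finset.sum_congr rfl fun k _ => ?_
  ring

end Wave

/-- The error of the approximation of a solution of `U'' = (Q - ω²) U` by `c` plus integrals of
generalized wave polynomials, in terms of the error on the characteristic. -/
theorem norm_sub_waveIntegral_le {b C M ε : ℝ} {ω : ℂ} (hC : 0 ≤ C) (h0 : ω ≠ 0)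
    (hω : |ω.im| ≤ C) (hM : 0 ≤ M) {P : ℕ → Prop} [DecidablePred P] (hP : ∀ k, P (k + 2) ↔ P k)
    {Q U U' G c d : ℝ → ℂ} {φ ψ : ℕ → ℝ → ℂ}
    (hQ : ContinuousOn Q (Ioo (-b) b)) (hQM : ∀ x ∈ Ioo (-b) b, ‖Q x‖ ≤ M)
    (hU : ∀ x ∈ Ioo (-b) b, HasDerivAt U (U' x) x)
    (hU' : ∀ x ∈ Ioo (-b) b, HasDerivAt U' ((Q x - ω ^ 2) * U x) x)
    (hφ : ∀ x ∈ Ioo (-b) b, ∀ k, HasDerivAt (φ k) (ψ k x) x)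
    (hψ : ∀ x ∈ Ioo (-b) b, ∀ k : ℕ,
      HasDerivAt (ψ k) (Q x * φ k x + k * ((k : ℂ) - 1) * φ (k - 2) x) x)
    (hG : ∀ x ∈ Ioo (-b) b, HasDerivAt G (Q x / 4) x)
    (hc : ∀ x, HasDerivAt c (d x) x) (hd : ∀ x, HasDerivAt d (-ω ^ 2 * c x) x)
    (hd0 : P 0 → d 0 = 0) (hc0 : P 1 → c 0 = 0) (hc1 : ‖c 0‖ ≤ 1)
    (hU0 : U 0 = c 0) (hU'0 : U' 0 = d 0 + 2 * G 0 * c 0)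
    (hcd : ∀ x s : ℝ, ‖Complex.sin (ω * ((x - s : ℝ) : ℂ)) / ω * d s -
      Complex.cos (ω * ((x - s : ℝ) : ℂ)) * c s‖ ≤ Real.cosh (C * (x - 2 * s)))
    (s : Finset ℕ) (a : ℕ → ℂ)
    (hε : ∀ x ∈ Ioo (-b) b, ‖G x - ∑ n ∈ s, a n * waveTrace P φ n x‖ ≤ ε) :
    ∀ x ∈ Ioo (-b) b, ‖U x - (c x + 2 * ∑ n ∈ s, a n * waveIntegral P φ c n x)‖ ≤
      6 * ε * Real.exp (M * b ^ 2) * sinhDiv C b := by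
  have hcc : Continuous c := continuous_iff_continuousAt.2 fun x => (hc x).continuousAt
  refine norm_le_of_residual (e := fun x => U x - (c x + 2 * ∑ n ∈ s, a n * waveIntegral P φ c n x))
    (e' := fun x => U' x - (d x + 2 * ∑ n ∈ s, a n * waveIntegral' P φ ψ c n x))
    (D := fun x => ∑ n ∈ s, a n * waveTrace P φ n x - G x)
    (D' := fun x => ∑ n ∈ s, a n * waveTrace' P φ ψ n x - Q x / 4) hC h0 hω hM hQ hQM
    ?_ ?_ ?_ hc hd ?_ ?_ hc1 hcd (fun x hx => by rw [norm_sub_rev]; exact hε x hx)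
  · intro x hx
    exact (hU x hx).fun_sub ((hc x).fun_add ((HasDerivAt.fun_sum fun n _ =>
      (hasDerivAt_waveIntegral (hφ x hx) hcc n).const_mul (a n)).const_mul 2))
  · intro x hx
    have h := (hU' x hx).fun_sub ((hd x).fun_add ((HasDerivAt.fun_sum (u := s) fun n _ =>
      (hasDerivAt_waveIntegral' hP hd0 hc0 (hφ x hx) (hψ x hx) hc hd n).const_mul (a n)).const_mul 2))
    convert! h using 1
    have e : ∑ n ∈ s, a n * ((Q x - ω ^ 2) * waveIntegral P φ c n x +
        2 * waveTrace' P φ ψ n x * c x) = (Q x - ω ^ 2) * ∑ n ∈ s, a n * waveIntegral P φ c n x +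
        2 * (∑ n ∈ s, a n * waveTrace' P φ ψ n x) * c x := by
      simp only [Finset.mul_sum, Finset.sum_mul]
      rw [← Finset.sum_add_distrib]
      refine Finset.sum_congr rfl fun n _ => ?_
      ring
    rw [e]
    ring
  · intro x hx
    exact (HasDerivAt.fun_sum fun n _ =>
      (hasDerivAt_waveTrace (hφ x hx) n).const_mul (a n)).fun_sub (hG x hx)
  · simp [hU0, waveIntegral]
  · have : ∀ n, waveIntegral' P φ ψ c n 0 = waveTrace P φ n 0 * c 0 := by
      intro n
      rw [waveIntegral', waveTrace, Finset.sum_mul]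
      refine Finset.sum_congr rfl fun k _ => ?_
      simp only [intervalIntegral.integral_same]
      ring
    simp only [hU'0, this]
    have e : ∑ n ∈ s, a n * (waveTrace P φ n 0 * c 0) =
        (∑ n ∈ s, a n * waveTrace P φ n 0) * c 0 := by
      rw [Finset.sum_mul]
      exact Finset.sum_congr rfl fun n _ => by ring
    rw [e]
    ring

/-! ### Locally absolutely continuous functions -/

section ACloc

variable {A B : ℝ} {E : Type*} [NormedAddCommGroup E]

theorem ACloc.continuousOn {f : ℝ → E} (hf : ACloc A B f) : ContinuousOn f (Ioo A B) := by
  intro y hy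
  obtain ⟨c, hc, hcy⟩ := exists_between hy.1
  obtain ⟨d, hyd, hd⟩ := exists_between hy.2
  have h := (hf c d hc (hcy.trans hyd).le hd).continuousOn
  rw [uIcc_of_le (hcy.trans hyd).le] at h
  exact (h.continuousAt (Icc_mem_nhds hcy hyd)).continuousWithinAt

theorem ACloc.add {f g : ℝ → E} (hf : ACloc A B f) (hg : ACloc A B g) :
    ACloc A B (fun y => f y + g y) := fun c d hc hcd hd =>
  (hf c d hc hcd hd).fun_add (hg c d hc hcd hd)

variable [NormedSpace ℝ E]

theorem ACloc.smul {f : ℝ → ℝ} {g : ℝ → E} (hf : ACloc A B f) (hg : ACloc A B g) :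
    ACloc A B (fun y => f y • g y) := fun c d hc hcd hd =>
  (hf c d hc hcd hd).fun_smul (hg c d hc hcd hd)

theorem ACloc.mul {f g : ℝ → ℝ} (hf : ACloc A B f) (hg : ACloc A B g) :
    ACloc A B (fun y => f y * g y) := hf.smul hg

theorem ACloc.ae_differentiableAt [FiniteDimensional ℝ E] {f : ℝ → E} (hf : ACloc A B f) :
    ∀ᵐ y ∂(volume.restrict (Ioo A B)), DifferentiableAt ℝ f y := by
  refine ae_restrict_of_ae_restrict_inter_Ioo fun c d hc hd hcd => ?_
  rw [ae_restrict_iff' (measurableSet_Ioo.inter measurableSet_Ioo)]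
  filter_upwards [(hf c d hc.1 hcd.le hd.2).boundedVariationOn.ae_differentiableAt_of_mem_uIcc]
    with y hy hy'
  exact hy (uIcc_of_le hcd.le ▸ Ioo_subset_Icc_self hy'.2)

theorem absolutelyContinuousOnInterval_of_hasDerivAt {f f' : ℝ → E} {c d : ℝ} (hcd : c ≤ d)
    (hf : ∀ y ∈ Icc c d, HasDerivWithinAt f (f' y) (Icc c d) y) (hf' : ContinuousOn f' (Icc c d)) :
    AbsolutelyContinuousOnInterval f c d := by
  obtain ⟨K, hK⟩ := isCompact_Icc.exists_bound_of_continuousOn hf'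
  refine LipschitzOnWith.absolutelyContinuousOnInterval (K := K.toNNReal) ?_
  rw [uIcc_of_le hcd]
  refine (convex_Icc c d).lipschitzOnWith_of_nnnorm_hasDerivWithin_le hf fun y hy => ?_
  exact NNReal.le_toNNReal_of_coe_le (by simpa using hK y hy)

theorem ACloc.of_hasDerivAt {f f' : ℝ → E} (hf : ∀ y ∈ Ioo A B, HasDerivAt f (f' y) y)
    (hf' : ContinuousOn f' (Ioo A B)) : ACloc A B f := fun _ _ hc hcd hd =>
  absolutelyContinuousOnInterval_of_hasDerivAt hcd
    (fun y hy => (hf y ⟨hc.trans_le hy.1, hy.2.trans_lt hd⟩).hasDerivWithinAt)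
    (hf'.mono fun _ hy => ⟨hc.trans_le hy.1, hy.2.trans_lt hd⟩)

/-- A locally absolutely continuous function whose derivative agrees almost everywhere with a
continuous function is continuously differentiable. -/
theorem ACloc.hasDerivAt [CompleteSpace E] {f f' : ℝ → E} (hf : ACloc A B f)
    (hf' : ContinuousOn f' (Ioo A B))
    (h : ∀ᵐ y ∂(volume.restrict (Ioo A B)), HasDerivAt f (f' y) y) :
    ∀ y ∈ Ioo A B, HasDerivAt f (f' y) y := by
  intro y hy
  obtain ⟨c, hc, hcy⟩ := exists_between hy.1
  obtain ⟨d, hyd, hd⟩ := exists_between hy.2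
  have hcd : c ≤ d := (hcy.trans hyd).le
  have hu : uIcc c d = Icc c d := uIcc_of_le hcd
  have hsub : Icc c d ⊆ Ioo A B := fun s hs => ⟨hc.trans_le hs.1, hs.2.trans_lt hd⟩
  have hF : ∀ s ∈ Ioo A B, HasDerivAt (fun u => ∫ t in c..u, f' t) (f' s) s := by
    intro s hs
    refine intervalIntegral.integral_hasDerivAt_right ?_
      (hf'.stronglyMeasurableAtFilter isOpen_Ioo s hs) (hf'.continuousAt (isOpen_Ioo.mem_nhds hs))
    exact (hf'.mono (ordConnected_Ioo.uIcc_subset ⟨hc, hcy.trans hy.2⟩ hs)).intervalIntegrable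
  have hac : AbsolutelyContinuousOnInterval (fun u => ∫ t in c..u, f' t) c d :=
    absolutelyContinuousOnInterval_of_hasDerivAt hcd (fun s hs => (hF s (hsub hs)).hasDerivWithinAt)
      (hf'.mono hsub)
  -- The difference of `f` and the primitive of `f'` is absolutely continuous with derivative zero
  -- almost everywhere, hence constant. Continuity and almost everywhere differentiability alone
  -- would not suffice.
  obtain ⟨K, hK⟩ := ((hf c d hc hcd hd).fun_sub hac).const_of_ae_hasDerivAt_zero (by
    rw [ae_restrict_iff' measurableSet_Ioo] at h
    filter_upwards [h] with s hs hs'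
    have hs1 := hsub (hu ▸ hs')
    simpa using (hs hs1).fun_sub (hF s hs1))
  have heq : f =ᶠ[𝓝 y] fun u => (∫ t in c..u, f' t) + K := by
    filter_upwards [Icc_mem_nhds hcy hyd] with s hs
    rw [← hK s (hu ▸ hs)]
    abel
  exact ((hF y hy).add_const K).congr_of_eventuallyEq heq

/-- `deriv` is 0 where the function is not differentiable. By almost everywhere differentiability
this default occurs only on a null set, and continuity of `deriv f` then rules it out. -/
theorem ACloc.hasDerivAt_deriv [FiniteDimensional ℝ E] {f : ℝ → E} (hf : ACloc A B f)
    (hf' : ContinuousOn (deriv f) (Ioo A B)) : ∀ y ∈ Ioo A B, HasDerivAt f (deriv f y) y := by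
  have := FiniteDimensional.complete ℝ E
  refine hf.hasDerivAt hf' ?_
  filter_upwards [hf.ae_differentiableAt] with y hy
  exact hy.hasDerivAt

end ACloc

/-! ### The Liouville transformation -/

/-- The quantity `p ρ' / ρ² = -p (1 / ρ)'`, written out. -/
noncomputable def eta (p r : ℝ → ℝ) (y : ℝ) : ℝ :=
  1 / 4 * (p y * ((p y * r y) ^ (-(5 / 4) : ℝ) * (deriv p y * r y + p y * deriv r y)))

/-- The powers of `p` and `r` in terms of fourth roots. -/
theorem exists_fourth_roots {x y : ℝ} (hx : 0 < x) (hy : 0 < y) :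
    ∃ s t : ℝ, 0 < s ∧ 0 < t ∧ x = s ^ 4 ∧ y = t ^ 4 ∧ (x * y) ^ (1 / 4 : ℝ) = s * t ∧
      (x * y) ^ (-(1 / 4) : ℝ) = 1 / (s * t) ∧ Real.sqrt (y / x) = t ^ 2 / s ^ 2 ∧
      Real.sqrt (x / y) = s ^ 2 / t ^ 2 ∧ ((y ^ 3)⁻¹ * x) ^ (1 / 4 : ℝ) = s / t ^ 3 := by
  obtain ⟨s, hs, rfl⟩ : ∃ s : ℝ, 0 < s ∧ x = s ^ 4 :=
    ⟨x ^ (1 / 4 : ℝ), Real.rpow_pos_of_pos hx _, by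
      rw [← Real.rpow_natCast, ← Real.rpow_mul hx.le]; norm_num⟩
  obtain ⟨t, ht, rfl⟩ : ∃ t : ℝ, 0 < t ∧ y = t ^ 4 :=
    ⟨y ^ (1 / 4 : ℝ), Real.rpow_pos_of_pos hy _, by
      rw [← Real.rpow_natCast, ← Real.rpow_mul hy.le]; norm_num⟩
  have root : ∀ u : ℝ, 0 < u → (u ^ 4) ^ (1 / 4 : ℝ) = u := fun u hu => by
    rw [← Real.rpow_natCast, ← Real.rpow_mul hu.le]; norm_num
  refine ⟨s, t, hs, ht, rfl, rfl, ?_, ?_, ?_, ?_, ?_⟩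
  · rw [← mul_pow, root _ (by positivity)]
  · rw [← mul_pow, Real.rpow_neg (by positivity), root _ (by positivity), one_div]
  · rw [show t ^ 4 / s ^ 4 = (t ^ 2 / s ^ 2) ^ 2 by ring, Real.sqrt_sq (by positivity)]
  · rw [show s ^ 4 / t ^ 4 = (s ^ 2 / t ^ 2) ^ 2 by ring, Real.sqrt_sq (by positivity)]
  · rw [show ((t ^ 4) ^ 3)⁻¹ * s ^ 4 = (s / t ^ 3) ^ 4 by field_simp, root _ (by positivity)]

namespace IsLiouville

variable {A B b y₀ : ℝ} {p r : ℝ → ℝ}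

theorem hasDerivAt_p (h : IsLiouville A B b y₀ p r) : ∀ y ∈ Ioo A B, HasDerivAt p (deriv p y) y :=
  h.p_ac.hasDerivAt_deriv h.p'_ac.continuousOn

theorem hasDerivAt_r (h : IsLiouville A B b y₀ p r) : ∀ y ∈ Ioo A B, HasDerivAt r (deriv r y) y :=
  h.r_ac.hasDerivAt_deriv h.r'_ac.continuousOn

theorem pr_pos (h : IsLiouville A B b y₀ p r) {y : ℝ} (hy : y ∈ Ioo A B) : 0 < p y * r y :=
  mul_pos (h.p_pos y hy) (h.r_pos y hy)

theorem rho_pos (h : IsLiouville A B b y₀ p r) {y : ℝ} (hy : y ∈ Ioo A B) : 0 < rho p r y :=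
  Real.rpow_pos_of_pos (h.pr_pos hy) _

theorem hasDerivAt_rpow (h : IsLiouville A B b y₀ p r) (α : ℝ) {y : ℝ} (hy : y ∈ Ioo A B) :
    HasDerivAt (fun s => (p s * r s) ^ α)
      ((deriv p y * r y + p y * deriv r y) * α * (p y * r y) ^ (α - 1)) y :=
  ((h.hasDerivAt_p y hy).fun_mul (h.hasDerivAt_r y hy)).rpow_const (Or.inl (h.pr_pos hy).ne')

theorem continuousOn_rpow (h : IsLiouville A B b y₀ p r) (α : ℝ) :
    ContinuousOn (fun s => (p s * r s) ^ α) (Ioo A B) := fun _ hy =>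
  (h.hasDerivAt_rpow α hy).continuousAt.continuousWithinAt

theorem acloc_rpow (h : IsLiouville A B b y₀ p r) (α : ℝ) :
    ACloc A B (fun s => (p s * r s) ^ α) := by
  refine ACloc.of_hasDerivAt (fun y hy => h.hasDerivAt_rpow α hy) ?_
  exact (((h.p'_ac.continuousOn.mul h.r_ac.continuousOn).add
    (h.p_ac.continuousOn.mul h.r'_ac.continuousOn)).mul continuousOn_const).mul
    (h.continuousOn_rpow _)

/-- Only first derivatives of p and r enter `eta`, and these are locally absolutely continuous. -/
theorem acloc_eta (h : IsLiouville A B b y₀ p r) : ACloc A B (eta p r) := by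
  have := (h.p_ac.mul ((h.acloc_rpow (-(5 / 4))).mul
    ((h.p'_ac.mul h.r_ac).add (h.p_ac.mul h.r'_ac))))
  exact fun c d hc hcd hd => (this c d hc hcd hd).const_mul (1 / 4)

theorem hasDerivAt_rpow_neg (h : IsLiouville A B b y₀ p r) {y : ℝ} (hy : y ∈ Ioo A B) :
    HasDerivAt (fun s => (p s * r s) ^ (-(1 / 4) : ℝ)) (-(eta p r y / p y)) y := by
  convert! h.hasDerivAt_rpow (-(1 / 4)) hy using 1
  have := (h.p_pos y hy).ne'
  rw [eta, show (-(1 / 4) - 1 : ℝ) = -(5 / 4) by norm_num]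
  field_simp

theorem hasDerivAt_rho (h : IsLiouville A B b y₀ p r) {y : ℝ} (hy : y ∈ Ioo A B) :
    HasDerivAt (rho p r) (eta p r y * rho p r y ^ 2 / p y) y := by
  have := (h.p_pos y hy).ne'
  refine (h.hasDerivAt_rpow (1 / 4) hy).congr_deriv ?_
  have e : rho p r y ^ 2 = (p y * r y) ^ (1 / 2 : ℝ) := by
    rw [rho, ← Real.rpow_natCast, ← Real.rpow_mul (h.pr_pos hy).le]; norm_num
  have e2 : (p y * r y) ^ (1 / 4 - 1 : ℝ) =
      (p y * r y) ^ (-(5 / 4) : ℝ) * (p y * r y) ^ (1 / 2 : ℝ) := by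
    rw [← Real.rpow_add (h.pr_pos hy)]; norm_num
  rw [e, e2, eta]
  field_simp

/-- p (1/ρ)' equals -`eta` on a neighbourhood of the point, so the two `deriv` values agree even
where `eta` is not differentiable. -/
theorem innerTerm_eq (h : IsLiouville A B b y₀ p r) {y : ℝ} (hy : y ∈ Ioo A B) :
    innerTerm p r y = -deriv (eta p r) y := by
  have hneg : deriv (fun s => -eta p r s) y = -deriv (eta p r) y := by simp
  rw [innerTerm, ← hneg]
  refine Filter.EventuallyEq.deriv_eq ?_
  filter_upwards [isOpen_Ioo.mem_nhds hy] with s hs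
  rw [(h.hasDerivAt_rpow_neg hs).deriv]
  have := (h.p_pos s hs).ne'
  field_simp

/-- The transformed potential in the variable of the original equation. -/
theorem potential_identity (h : IsLiouville A B b y₀ p r) {q Q : ℝ → ℂ}
    (hQ : IsPotential A B y₀ p r q Q) :
    ∀ᵐ y ∂(volume.restrict (Ioo A B)), q y / (rho p r y : ℂ) - (innerTerm p r y : ℂ) =
      (Real.sqrt (r y / p y) : ℂ) * (Q (ell p r y₀ y) * (rho p r y : ℂ)) := by
  filter_upwards [hQ, ae_restrict_mem measurableSet_Ioo] with y hy hy'
  -- With p = s⁴ and r = t⁴ every fractional power becomes rational in s and t.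
  obtain ⟨s, t, hs, ht, hp, hr, h1, h2, h3, h4, h5⟩ :=
    exists_fourth_roots (h.p_pos y hy') (h.r_pos y hy')
  rw [hy, rho, h1, h3, h5, hr]
  have hs' : (s : ℂ) ≠ 0 := by exact_mod_cast hs.ne'
  have ht' : (t : ℂ) ≠ 0 := by exact_mod_cast ht.ne'
  push_cast
  field_simp

end IsLiouville

/-- The quasi-derivative `p v' / ρ + (p ρ' / ρ²) v`, which is the derivative of the Liouville
transform of `v`. -/
noncomputable def quasiDeriv (p r : ℝ → ℝ) (v : ℝ → ℂ) (y : ℝ) : ℂ :=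
  (p y * r y) ^ (-(1 / 4) : ℝ) • ((p y : ℂ) * deriv v y) + eta p r y • v y

namespace IsLiouville

variable {A B b y₀ : ℝ} {p r : ℝ → ℝ}

theorem sqrt_pos (h : IsLiouville A B b y₀ p r) {y : ℝ} (hy : y ∈ Ioo A B) :
    0 < Real.sqrt (r y / p y) :=
  Real.sqrt_pos.2 (div_pos (h.r_pos y hy) (h.p_pos y hy))

theorem continuousOn_sqrt (h : IsLiouville A B b y₀ p r) :
    ContinuousOn (fun y => Real.sqrt (r y / p y)) (Ioo A B) :=
  (h.r_ac.continuousOn.div h.p_ac.continuousOn fun y hy => (h.p_pos y hy).ne').sqrt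

theorem mem_Icc (h : IsLiouville A B b y₀ p r) : y₀ ∈ Icc A B := Ioo_subset_Icc_self h.mem

theorem le (h : IsLiouville A B b y₀ p r) : A ≤ B := h.mem_Icc.1.trans h.mem_Icc.2

theorem hasDerivAt_ell (h : IsLiouville A B b y₀ p r) {y : ℝ} (hy : y ∈ Ioo A B) :
    HasDerivAt (ell p r y₀) (Real.sqrt (r y / p y)) y := by
  have hc := h.continuousOn_sqrt
  refine intervalIntegral.integral_hasDerivAt_right ?_
    (hc.stronglyMeasurableAtFilter isOpen_Ioo y hy) (hc.continuousAt (isOpen_Ioo.mem_nhds hy))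
  exact (hc.mono (ordConnected_Ioo.uIcc_subset h.mem hy)).intervalIntegrable

theorem continuousOn_ell (h : IsLiouville A B b y₀ p r) :
    ContinuousOn (ell p r y₀) (Icc A B) := by
  rw [← uIcc_of_le h.le]
  exact intervalIntegral.continuousOn_primitive_interval' h.integrable
    (uIcc_of_le h.le ▸ h.mem_Icc)

theorem ell_self (p r : ℝ → ℝ) (y₀ : ℝ) : ell p r y₀ y₀ = 0 := intervalIntegral.integral_same

theorem ell_left (h : IsLiouville A B b y₀ p r) : ell p r y₀ A = -b := by
  rw [ell, intervalIntegral.integral_symm, h.left_length]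

theorem strictMonoOn_ell (h : IsLiouville A B b y₀ p r) :
    StrictMonoOn (ell p r y₀) (Icc A B) := by
  refine strictMonoOn_of_deriv_pos (convex_Icc A B) h.continuousOn_ell fun y hy => ?_
  rw [interior_Icc] at hy
  rw [(h.hasDerivAt_ell hy).deriv]
  exact h.sqrt_pos hy

theorem ell_mem (h : IsLiouville A B b y₀ p r) {y : ℝ} (hy : y ∈ Ioo A B) :
    ell p r y₀ y ∈ Ioo (-b) b := by
  have hy' := Ioo_subset_Icc_self hy
  constructor
  · rw [← h.ell_left]
    exact h.strictMonoOn_ell ⟨le_rfl, h.le⟩ hy' hy.1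
  · rw [← h.right_length]
    exact h.strictMonoOn_ell hy' ⟨h.le, le_rfl⟩ hy.2

/-- The inverse of the Liouville change of variable. -/
theorem exists_inverse (h : IsLiouville A B b y₀ p r) :
    ∃ m : ℝ → ℝ, (∀ y ∈ Ioo A B, m (ell p r y₀ y) = y) ∧
      (∀ x ∈ Ioo (-b) b, m x ∈ Ioo A B ∧ ell p r y₀ (m x) = x) ∧
      ∀ x ∈ Ioo (-b) b, HasDerivAt m (Real.sqrt (r (m x) / p (m x)))⁻¹ x := by
  have hsurj : ∀ x ∈ Ioo (-b) b, ∃ y ∈ Ioo A B, ell p r y₀ y = x := fun x hx => by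
    have := intermediate_value_Ioo h.le h.continuousOn_ell
    rw [h.ell_left, show ell p r y₀ B = b from h.right_length] at this
    exact this hx
  have hmono := h.strictMonoOn_ell.mono Ioo_subset_Icc_self
  set m := Function.invFunOn (ell p r y₀) (Ioo A B)
  have hm : ∀ x ∈ Ioo (-b) b, m x ∈ Ioo A B ∧ ell p r y₀ (m x) = x := fun x hx =>
    ⟨Function.invFunOn_mem (hsurj x hx), Function.invFunOn_eq (hsurj x hx)⟩
  have hm' : ∀ y ∈ Ioo A B, m (ell p r y₀ y) = y := fun y hy =>
    hmono.injOn (hm _ (h.ell_mem hy)).1 hy (hm _ (h.ell_mem hy)).2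
  refine ⟨m, hm', hm, fun x hx => ?_⟩
  have hmm : StrictMonoOn m (Ioo (-b) b) := fun x hx x' hx' hxx' => by
    rwa [← hmono.lt_iff_lt (hm x hx).1 (hm x' hx').1, (hm x hx).2, (hm x' hx').2]
  have himage : m '' Ioo (-b) b = Ioo A B := by
    refine Subset.antisymm ?_ fun y hy => ⟨_, h.ell_mem hy, hm' y hy⟩
    rintro _ ⟨x, hx, rfl⟩
    exact (hm x hx).1
  -- A strictly monotone map whose image is a neighbourhood of the value is continuous there.
  have hcont : ContinuousAt m x := hmm.continuousAt_of_image_mem_nhds (isOpen_Ioo.mem_nhds hx)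
    (himage ▸ isOpen_Ioo.mem_nhds (hm x hx).1)
  refine HasDerivAt.of_local_left_inverse hcont (h.hasDerivAt_ell (hm x hx).1)
    (h.sqrt_pos (hm x hx).1).ne' ?_
  filter_upwards [isOpen_Ioo.mem_nhds hx] with t ht
  exact (hm t ht).2

theorem quasiDeriv_eq (h : IsLiouville A B b y₀ p r) {v : ℝ → ℂ} {y : ℝ} (hy : y ∈ Ioo A B) :
    quasiDeriv p r v y = 1 / (rho p r y : ℂ) * ((p y : ℂ) * deriv v y) + (eta p r y : ℂ) * v y := by
  have e : (p y * r y) ^ (-(1 / 4) : ℝ) = 1 / rho p r y := by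
    rw [rho, Real.rpow_neg (h.pr_pos hy).le, one_div (_ ^ _)]
  rw [quasiDeriv, e]
  simp only [Complex.real_smul]
  push_cast
  rfl

/-- Solutions are continuously differentiable. -/
theorem hasDerivAt_solution (h : IsLiouville A B b y₀ p r) {q v : ℝ → ℂ} {lam : ℂ}
    (hv : IsSolution A B p r q lam v) : ∀ y ∈ Ioo A B, HasDerivAt v (deriv v y) y := by
  refine hv.ac.hasDerivAt_deriv ?_
  have hp : ContinuousOn (fun y => (p y : ℂ)) (Ioo A B) :=
    Complex.continuous_ofReal.comp_continuousOn h.p_ac.continuousOn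
  have hp0 : ∀ y ∈ Ioo A B, (p y : ℂ) ≠ 0 := fun y hy => by
    exact_mod_cast (h.p_pos y hy).ne'
  -- v' is the quotient of the continuous quasi-derivative p v' by p > 0.
  refine (hv.ac_quasi.continuousOn.div hp hp0).congr fun y hy => ?_
  have := hp0 y hy
  simp only [Pi.div_apply]
  field_simp

/-- The Liouville transform `ρ v` of a solution has `quasiDeriv` as its derivative. -/
theorem hasDerivAt_rho_mul (h : IsLiouville A B b y₀ p r) {q v : ℝ → ℂ} {lam : ℂ}
    (hv : IsSolution A B p r q lam v) {y : ℝ} (hy : y ∈ Ioo A B) :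
    HasDerivAt (fun s => (rho p r s : ℂ) * v s)
      ((Real.sqrt (r y / p y) : ℂ) * quasiDeriv p r v y) y := by
  have h1 := (h.hasDerivAt_rho hy).ofReal_comp.fun_mul (h.hasDerivAt_solution hv y hy)
  refine h1.congr_deriv ?_
  rw [h.quasiDeriv_eq hy]
  obtain ⟨s, t, hs, ht, hp, hr, h1, h2, h3, h4, h5⟩ :=
    exists_fourth_roots (h.p_pos y hy) (h.r_pos y hy)
  have hs' : (s : ℂ) ≠ 0 := by exact_mod_cast hs.ne'
  have ht' : (t : ℂ) ≠ 0 := by exact_mod_cast ht.ne'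
  rw [rho, h1, h3, hp]
  push_cast
  field_simp
  ring

/-- The Liouville transform of a solution solves the transformed equation, classically. -/
theorem hasDerivAt_quasiDeriv (h : IsLiouville A B b y₀ p r) {q v Q : ℝ → ℂ} {lam : ℂ}
    (hQc : ContinuousOn Q (Icc (-b) b)) (hQ : IsPotential A B y₀ p r q Q)
    (hv : IsSolution A B p r q lam v) : ∀ y ∈ Ioo A B, HasDerivAt (quasiDeriv p r v)
      ((Real.sqrt (r y / p y) : ℂ) *
        ((Q (ell p r y₀ y) - lam) * ((rho p r y : ℂ) * v y))) y := by
  have hac : ACloc A B (quasiDeriv p r v) :=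
    ((h.acloc_rpow (-(1 / 4))).smul hv.ac_quasi).add (h.acloc_eta.smul hv.ac)
  have hQl : ContinuousOn (fun y => Q (ell p r y₀ y)) (Ioo A B) :=
    hQc.comp (h.continuousOn_ell.mono Ioo_subset_Icc_self) fun y hy =>
      Ioo_subset_Icc_self (h.ell_mem hy)
  -- The derivative is computed almost everywhere, where p'' and r'' make sense. The resulting
  -- expression is continuous because Q is, so absolute continuity extends the formula to every
  -- point.
  refine hac.hasDerivAt ?_ ?_
  · exact (Complex.continuous_ofReal.comp_continuousOn h.continuousOn_sqrt).mul
      ((hQl.sub continuousOn_const).mul ((Complex.continuous_ofReal.comp_continuousOn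
        (h.rho_cont.mono Ioo_subset_Icc_self)).mul hv.ac.continuousOn))
  · filter_upwards [hv.eqn, h.potential_identity hQ, hv.ac_quasi.ae_differentiableAt,
      h.acloc_eta.ae_differentiableAt, ae_restrict_mem measurableSet_Ioo] with y he hpot hd1 hd2 hy
    have h1 := ((h.hasDerivAt_rpow_neg hy).fun_smul hd1.hasDerivAt).fun_add
      (hd2.hasDerivAt.fun_smul (h.hasDerivAt_solution hv y hy))
    refine h1.congr_deriv ?_
    have hi := h.innerTerm_eq hy
    have e : deriv (eta p r) y = -innerTerm p r y := by rw [hi, neg_neg]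
    rw [e]
    obtain ⟨s, t, hs, ht, hp, hr, h1, h2, h3, h4, h5⟩ :=
      exists_fourth_roots (h.p_pos y hy) (h.r_pos y hy)
    have hs' : (s : ℂ) ≠ 0 := by exact_mod_cast hs.ne'
    have ht' : (t : ℂ) ≠ 0 := by exact_mod_cast ht.ne'
    have he' := eq_add_of_sub_eq he
    rw [he', h2]
    have hp0 : (p y : ℂ) ≠ 0 := by exact_mod_cast (h.p_pos y hy).ne'
    -- The two first-order terms in v' cancel; this is why the term `eta` · v belongs in
    -- `quasiDeriv`.
    have e1 : (eta p r y / p y : ℝ) • ((p y : ℂ) * deriv v y) = eta p r y • deriv v y := by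
      simp only [Complex.real_smul]
      push_cast
      field_simp
    have e2 : (Real.sqrt (r y / p y) : ℂ) * (rho p r y : ℂ) =
        ((1 / (s * t) : ℝ) : ℂ) * (r y : ℂ) := by
      rw [rho, h1, h3, hr]
      push_cast
      field_simp
    have e3 : ((1 / (s * t) : ℝ) : ℂ) * q y - (innerTerm p r y : ℂ) =
        (Real.sqrt (r y / p y) : ℂ) * (Q (ell p r y₀ y) * (rho p r y : ℂ)) := by
      rw [← hpot, rho, h1]
      push_cast
      ring
    rw [neg_smul, e1]
    simp only [Complex.real_smul, Complex.ofReal_neg]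
    linear_combination (v y) * e3 + lam * v y * e2

/-- The function `G₂` is an antiderivative of a quarter of the transformed potential. -/
theorem hasDerivAt_G₂ (h : IsLiouville A B b y₀ p r) {q Q : ℝ → ℂ}
    (hQc : ContinuousOn Q (Icc (-b) b)) (hQ : IsPotential A B y₀ p r q Q) {y : ℝ}
    (hy : y ∈ Ioo A B) : HasDerivAt (G₂ p r q y₀)
      ((Real.sqrt (r y / p y) : ℂ) * (Q (ell p r y₀ y) / 4)) y := by
  have hQl : ContinuousOn (fun y => Q (ell p r y₀ y)) (Ioo A B) :=
    hQc.comp (h.continuousOn_ell.mono Ioo_subset_Icc_self) fun y hy =>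
      Ioo_subset_Icc_self (h.ell_mem hy)
  have hc : ContinuousOn (fun y => (Real.sqrt (r y / p y) : ℂ) * Q (ell p r y₀ y)) (Ioo A B) :=
    (Complex.continuous_ofReal.comp_continuousOn h.continuousOn_sqrt).mul hQl
  have heq : ∀ z ∈ Ioo A B, G₂ p r q y₀ z =
      1 / 4 * ∫ s in y₀..z, (Real.sqrt (r s / p s) : ℂ) * Q (ell p r y₀ s) := by
    intro z hz
    rw [G₂]
    congr 1
    -- Almost everywhere the integrand equals a continuous function, so no separate integrability of
    -- q is needed.
    refine intervalIntegral.integral_congr_ae ?_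
    have := (ae_restrict_iff' measurableSet_Ioo).1 (h.potential_identity hQ)
    filter_upwards [this] with s hs hs'
    have hs1 : s ∈ Ioo A B :=
      ordConnected_Ioo.uIcc_subset h.mem hz (uIoc_subset_uIcc hs')
    rw [hs hs1]
    have : (rho p r s : ℂ) ≠ 0 := by exact_mod_cast (h.rho_pos hs1).ne'
    field_simp
  have hd : HasDerivAt (fun z => 1 / 4 * ∫ s in y₀..z,
      (Real.sqrt (r s / p s) : ℂ) * Q (ell p r y₀ s))
      (1 / 4 * ((Real.sqrt (r y / p y) : ℂ) * Q (ell p r y₀ y))) y := by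
    refine HasDerivAt.const_mul _ (intervalIntegral.integral_hasDerivAt_right ?_
      (hc.stronglyMeasurableAtFilter isOpen_Ioo y hy) (hc.continuousAt (isOpen_Ioo.mem_nhds hy)))
    exact (hc.mono (ordConnected_Ioo.uIcc_subset h.mem hy)).intervalIntegrable
  refine (hd.congr_of_eventuallyEq ?_).congr_deriv ?_
  · filter_upwards [isOpen_Ioo.mem_nhds hy] with z hz
    exact heq z hz
  ring

end IsLiouville

/-! ### Formal powers -/

/-- Differentiating the recurrence of the formal powers twice. -/
theorem hasDerivAt_formalPower {f f' : ℝ → ℂ} {Q α β : ℂ} {P₁ P₂ : ℝ → ℂ} {P₃ : ℂ} {x : ℝ}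
    (hf : HasDerivAt f (f' x) x) (hf' : HasDerivAt f' (Q * f x) x) (hfx : f x ≠ 0)
    (h₁ : HasDerivAt P₁ (α * (P₂ x * (1 / f x ^ 2))) x)
    (h₂ : HasDerivAt P₂ (β * (P₃ * f x ^ 2)) x) :
    HasDerivAt (fun t => f t * P₁ t) (f' x * P₁ x + α * P₂ x / f x) x ∧
      HasDerivAt (fun t => f' t * P₁ t + α * P₂ t / f t)
        (Q * (f x * P₁ x) + α * β * (f x * P₃)) x := by
  constructor
  · refine (hf.fun_mul h₁).congr_deriv ?_
    field_simp
  · refine ((hf'.fun_mul h₁).fun_add ((h₂.const_mul α).fun_div hf hfx)).congr_deriv ?_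
    field_simp
    ring

/-- The formal powers built from `f` and two families of recursive integrals. -/
noncomputable def formalPower (f : ℝ → ℂ) (Z Zt : ℕ → ℝ → ℂ) (k : ℕ) (x : ℝ) : ℂ :=
  if Odd k then f x * Z k x else f x * Zt k x

/-- The derivative of `formalPower`. -/
noncomputable def formalPower' (f f' : ℝ → ℂ) (Z Zt : ℕ → ℝ → ℂ) (k : ℕ) (x : ℝ) : ℂ :=
  if Odd k then f' x * Z k x + k * Z (k - 1) x / f x else f' x * Zt k x + k * Zt (k - 1) x / f x

section FormalPower

variable {f f' Q : ℝ → ℂ} {Z Zt : ℕ → ℝ → ℂ} {x : ℝ}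

/-- Choosing Z for odd k and Zt for even k makes the outermost weight always f⁻² and the next one
f². These are the weights for which two differentiations of f times the iterated integral close up.
-/
theorem hasDerivAt_formalPower_and (hf : HasDerivAt f (f' x) x)
    (hf' : HasDerivAt f' (Q x * f x) x) (hfx : f x ≠ 0)
    (hZ : ∀ k : ℕ, HasDerivAt (Z k)
      (k * (Z (k - 1) x * if Odd k then 1 / f x ^ 2 else f x ^ 2)) x)
    (hZt : ∀ k : ℕ, HasDerivAt (Zt k)
      (k * (Zt (k - 1) x * if Odd k then f x ^ 2 else 1 / f x ^ 2)) x) (k : ℕ) :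
    HasDerivAt (formalPower f Z Zt k) (formalPower' f f' Z Zt k x) x ∧
      HasDerivAt (formalPower' f f' Z Zt k)
        (Q x * formalPower f Z Zt k x + k * ((k : ℂ) - 1) * formalPower f Z Zt (k - 2) x) x := by
  by_cases hk : Odd k
  · have h₁ := hZ k
    have h₂ := hZ (k - 1)
    have hk1 : ¬ Odd (k - 1) := by rw [Nat.not_odd_iff_even]; exact Nat.Odd.sub_odd hk odd_one
    rw [if_pos hk] at h₁
    rw [if_neg hk1, Nat.cast_sub hk.pos, Nat.cast_one] at h₂
    have h := hasDerivAt_formalPower hf hf' hfx h₁ h₂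
    have e1 : formalPower f Z Zt k = fun t => f t * Z k t := by
      ext t; simp [formalPower, hk]
    have e2 : formalPower' f f' Z Zt k = fun t => f' t * Z k t + k * Z (k - 1) t / f t := by
      ext t; simp [formalPower', hk]
    -- At k = 1 truncated subtraction gives index 0, of the wrong parity; the factor k - 1 makes
    -- this harmless.
    have e3 : (k : ℂ) * ((k : ℂ) - 1) * formalPower f Z Zt (k - 2) x =
        k * ((k : ℂ) - 1) * (f x * Z (k - 1 - 1) x) := by
      obtain ⟨j, rfl⟩ := hk
      rcases j with _ | j
      · simp
      · have : Odd (2 * (j + 1) + 1 - 2) := ⟨j, by omega⟩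
        rw [formalPower, if_pos this]
        rfl
    rw [e1, e2, e3]
    exact h
  · have h₁ := hZt k
    have h₂ := hZt (k - 1)
    rw [if_neg hk] at h₁
    -- For k = 0 the truncated index k - 1 = 0 is even, but the coefficient is zero.
    have h₂' : HasDerivAt (Zt (k - 1))
        (((k - 1 : ℕ) : ℂ) * (Zt (k - 1 - 1) x * f x ^ 2)) x := by
      rcases Nat.eq_zero_or_pos k with rfl | hpos
      · simpa using h₂
      · have hk1 : Odd (k - 1) := Nat.Even.sub_odd hpos (Nat.not_odd_iff_even.1 hk) odd_one
        rwa [if_pos hk1] at h₂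
    have h := hasDerivAt_formalPower hf hf' hfx h₁ h₂'
    have e1 : formalPower f Z Zt k = fun t => f t * Zt k t := by
      ext t; simp [formalPower, hk]
    have e2 : formalPower' f f' Z Zt k = fun t => f' t * Zt k t + k * Zt (k - 1) t / f t := by
      ext t; simp [formalPower', hk]
    have e3 : (k : ℂ) * ((k : ℂ) - 1) * formalPower f Z Zt (k - 2) x =
        k * ((k - 1 : ℕ) : ℂ) * (f x * Zt (k - 1 - 1) x) := by
      obtain ⟨j, rfl⟩ := Nat.not_odd_iff_even.1 hk
      rcases j with _ | j
      · simp
      · have : ¬ Odd (j + 1 + (j + 1) - 2) := by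
          rw [Nat.not_odd_iff_even]; exact ⟨j, by omega⟩
        rw [formalPower, if_neg this, Nat.cast_sub (by omega), Nat.cast_one]
        rfl
    rw [e1, e2, e3]
    exact h

end FormalPower

/-! ### The recursive integrals -/

section Recursive

variable {A B b y₀ : ℝ} {p r : ℝ → ℝ} {g : ℝ → ℂ}

theorem continuousOn_integral_Icc {F : ℝ → ℂ} (hF : ContinuousOn F (Icc A B)) (hy₀ : y₀ ∈ Icc A B) :
    ContinuousOn (fun y => ∫ s in y₀..y, F s) (Icc A B) := by
  have hAB : A ≤ B := hy₀.1.trans hy₀.2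
  rw [← uIcc_of_le hAB] at *
  exact intervalIntegral.continuousOn_primitive_interval' hF.intervalIntegrable hy₀

theorem hasDerivAt_integral_Icc {F : ℝ → ℂ} (hF : ContinuousOn F (Icc A B)) (hy₀ : y₀ ∈ Icc A B)
    {y : ℝ} (hy : y ∈ Ioo A B) : HasDerivAt (fun y => ∫ s in y₀..y, F s) (F y) y :=
  intervalIntegral.integral_hasDerivAt_right
    (hF.mono (ordConnected_Icc.uIcc_subset hy₀ (Ioo_subset_Icc_self hy))).intervalIntegrable
    ((hF.mono Ioo_subset_Icc_self).stronglyMeasurableAtFilter isOpen_Ioo y hy)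
    (hF.continuousAt (Icc_mem_nhds hy.1 hy.2))

theorem continuousOn_Y (hg : IsAdmissible A B p r g) (hy₀ : y₀ ∈ Icc A B) (k : ℕ) :
    ContinuousOn (Y p r g y₀ k) (Icc A B) := by
  induction k with
  | zero => exact continuousOn_const
  | succ k ih =>
    refine continuousOn_const.mul (continuousOn_integral_Icc (ih.mul ?_) hy₀)
    split_ifs
    exacts [hg.cont_p, hg.cont_r]

theorem continuousOn_Ytilde (hg : IsAdmissible A B p r g) (hy₀ : y₀ ∈ Icc A B) (k : ℕ) :
    ContinuousOn (Ytilde p r g y₀ k) (Icc A B) := by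
  induction k with
  | zero => exact continuousOn_const
  | succ k ih =>
    refine continuousOn_const.mul (continuousOn_integral_Icc (ih.mul ?_) hy₀)
    split_ifs
    exacts [hg.cont_r, hg.cont_p]

theorem continuousOn_Phi (hg : IsAdmissible A B p r g) (hy₀ : y₀ ∈ Icc A B) (k : ℕ) :
    ContinuousOn (Phi p r g y₀ k) (Icc A B) := by
  unfold Phi
  split_ifs
  exacts [hg.cont.mul (continuousOn_Y hg hy₀ k), hg.cont.mul (continuousOn_Ytilde hg hy₀ k)]

theorem hasDerivAt_Y (hg : IsAdmissible A B p r g) (hy₀ : y₀ ∈ Icc A B) (k : ℕ) {y : ℝ}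
    (hy : y ∈ Ioo A B) : HasDerivAt (Y p r g y₀ k) (k * (Y p r g y₀ (k - 1) y *
      if Odd k then 1 / (g y ^ 2 * (p y : ℂ)) else g y ^ 2 * (r y : ℂ))) y := by
  rcases k with _ | k
  · exact (hasDerivAt_const y (1 : ℂ)).congr_deriv (by simp)
  · refine (hasDerivAt_integral_Icc (F := fun s => Y p r g y₀ k s *
      (if Odd (k + 1) then 1 / (g s ^ 2 * (p s : ℂ)) else g s ^ 2 * (r s : ℂ)))
      ((continuousOn_Y hg hy₀ k).mul ?_) hy₀ hy).const_mul _
    split_ifs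
    exacts [hg.cont_p, hg.cont_r]

theorem hasDerivAt_Ytilde (hg : IsAdmissible A B p r g) (hy₀ : y₀ ∈ Icc A B) (k : ℕ) {y : ℝ}
    (hy : y ∈ Ioo A B) : HasDerivAt (Ytilde p r g y₀ k) (k * (Ytilde p r g y₀ (k - 1) y *
      if Odd k then g y ^ 2 * (r y : ℂ) else 1 / (g y ^ 2 * (p y : ℂ)))) y := by
  rcases k with _ | k
  · exact (hasDerivAt_const y (1 : ℂ)).congr_deriv (by simp)
  · refine (hasDerivAt_integral_Icc (F := fun s => Ytilde p r g y₀ k s *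
      (if Odd (k + 1) then g s ^ 2 * (r s : ℂ) else 1 / (g s ^ 2 * (p s : ℂ))))
      ((continuousOn_Ytilde hg hy₀ k).mul ?_) hy₀ hy).const_mul _
    split_ifs
    exacts [hg.cont_r, hg.cont_p]

/-- The weights of the recursive integrals in the Liouville variable. -/
theorem IsLiouville.weights (h : IsLiouville A B b y₀ p r) {y : ℝ} (hy : y ∈ Ioo A B) (z : ℂ) :
    1 / (z ^ 2 * (p y : ℂ)) =
        (Real.sqrt (r y / p y) : ℂ) * (1 / ((rho p r y : ℂ) * z) ^ 2) ∧
      z ^ 2 * (r y : ℂ) = (Real.sqrt (r y / p y) : ℂ) * ((rho p r y : ℂ) * z) ^ 2 := by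
  obtain ⟨s, t, hs, ht, hp, hr, h1, h2, h3, h4, h5⟩ :=
    exists_fourth_roots (h.p_pos y hy) (h.r_pos y hy)
  have hs' : (s : ℂ) ≠ 0 := by exact_mod_cast hs.ne'
  have ht' : (t : ℂ) ≠ 0 := by exact_mod_cast ht.ne'
  rw [rho, h1, h3]
  constructor
  · rw [hp]
    by_cases hz : z = 0
    · simp [hz]
    · push_cast
      field_simp
  · rw [hr]
    push_cast
    field_simp

end Recursive

/-! ### Error estimate in the original variable -/

section Main

variable {A B b y₀ : ℝ} {p r : ℝ → ℝ} {g : ℝ → ℂ}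

/-- The error estimate on the open interval, for a multiple `κ v` of a solution and for either of
the two parity classes. -/
theorem norm_rho_mul_sub_le (h : IsLiouville A B b y₀ p r) {q Q : ℝ → ℂ}
    (hQc : ContinuousOn Q (Icc (-b) b)) (hQ : IsPotential A B y₀ p r q Q)
    (hg : IsSolution A B p r q 0 g) (hga : IsAdmissible A B p r g)
    {C M ε : ℝ} {ω : ℂ} (hC : 0 ≤ C) (h0 : ω ≠ 0) (hω : |ω.im| ≤ C)
    (hQM : ∀ x ∈ Icc (-b) b, ‖Q x‖ ≤ M)
    {P : ℕ → Prop} [DecidablePred P] (hP : ∀ k, P (k + 2) ↔ P k) {c d G v : ℝ → ℂ} {κ : ℂ}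
    (hv : IsSolution A B p r q (ω ^ 2) v)
    (hG : ∀ y ∈ Ioo A B,
      HasDerivAt G ((Real.sqrt (r y / p y) : ℂ) * (Q (ell p r y₀ y) / 4)) y)
    (hc : ∀ x, HasDerivAt c (d x) x) (hd : ∀ x, HasDerivAt d (-ω ^ 2 * c x) x)
    (hd0 : P 0 → d 0 = 0) (hc0 : P 1 → c 0 = 0) (hc1 : ‖c 0‖ ≤ 1)
    (hv0 : κ * ((rho p r y₀ : ℂ) * v y₀) = c 0)
    (hv'0 : κ * quasiDeriv p r v y₀ = d 0 + 2 * G y₀ * c 0)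
    (hcd : ∀ x s : ℝ, ‖Complex.sin (ω * ((x - s : ℝ) : ℂ)) / ω * d s -
      Complex.cos (ω * ((x - s : ℝ) : ℂ)) * c s‖ ≤ Real.cosh (C * (x - 2 * s)))
    (s : Finset ℕ) (a : ℕ → ℂ)
    (hε : ∀ y ∈ Icc A B, ‖G y - ∑ n ∈ s, a n * ((rho p r y : ℂ) *
      ∑ k ∈ (Finset.range (n + 1)).filter (fun k => P k),
        (n.choose k : ℂ) * (ell p r y₀ y : ℂ) ^ k * Phi p r g y₀ (n - k) y)‖ ≤ ε) :
    ∀ y ∈ Ioo A B, ‖κ * ((rho p r y : ℂ) * v y) - (c (ell p r y₀ y) +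
      2 * ∑ n ∈ s, a n * ((rho p r y : ℂ) *
        ∑ k ∈ (Finset.range (n + 1)).filter (fun k => P k), (n.choose k : ℂ) *
          Phi p r g y₀ (n - k) y * ∫ t in (0 : ℝ)..ell p r y₀ y, (t : ℂ) ^ k * c t))‖ ≤
      6 * ε * Real.exp (M * b ^ 2) * sinhDiv C b := by
  obtain ⟨m, hml, hm, hmd⟩ := h.exists_inverse
  -- Every derivative in y carries the factor l' = √(r/p), which the derivative of the inverse map
  -- cancels.
  have comp : ∀ {F : ℝ → ℂ} {D : ℂ} {x : ℝ}, x ∈ Ioo (-b) b →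
      HasDerivAt F ((Real.sqrt (r (m x) / p (m x)) : ℂ) * D) (m x) →
      HasDerivAt (fun t => F (m t)) D x := by
    intro F D x hx hF
    refine (hF.scomp x (hmd x hx)).congr_deriv ?_
    have : (Real.sqrt (r (m x) / p (m x)) : ℂ) ≠ 0 := by
      exact_mod_cast (h.sqrt_pos (hm x hx).1).ne'
    rw [Complex.real_smul]
    push_cast
    field_simp
  -- Under x = l(y) the measures ds/(g² p) and g² r ds become f⁻² dx and f² dx with f = (ρ g) ∘ l⁻¹.
  -- So the given recursive integrals already produce the formal powers of f, a solution of f'' = Q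
  -- f.
  set φ := formalPower (fun x => (rho p r (m x) : ℂ) * g (m x)) (fun k x => Y p r g y₀ k (m x))
    (fun k x => Ytilde p r g y₀ k (m x)) with hφdef
  have hφPhi : ∀ k, ∀ y ∈ Ioo A B, φ k (ell p r y₀ y) = (rho p r y : ℂ) * Phi p r g y₀ k y := by
    intro k y hy
    simp only [hφdef, formalPower, Phi, hml y hy]
    split_ifs <;> ring
  have hφ : ∀ x ∈ Ioo (-b) b, ∀ k, _ := fun x hx k =>
    hasDerivAt_formalPower_and (f := fun x => (rho p r (m x) : ℂ) * g (m x))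
      (f' := fun x => quasiDeriv p r g (m x)) (Q := Q)
      (Z := fun k x => Y p r g y₀ k (m x)) (Zt := fun k x => Ytilde p r g y₀ k (m x)) (x := x)
      (comp hx (h.hasDerivAt_rho_mul hg (hm x hx).1))
      (comp hx ((h.hasDerivAt_quasiDeriv hQc hQ hg _ (hm x hx).1).congr_deriv (by
        rw [(hm x hx).2, sub_zero])))
      (mul_ne_zero (by exact_mod_cast (h.rho_pos (hm x hx).1).ne')
        (hga.ne_zero _ (Ioo_subset_Icc_self (hm x hx).1)))
      (fun k => comp hx ((hasDerivAt_Y hga h.mem_Icc k (hm x hx).1).congr_deriv (by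
        rw [(h.weights (hm x hx).1 _).1, (h.weights (hm x hx).1 _).2]
        split_ifs <;> ring)))
      (fun k => comp hx ((hasDerivAt_Ytilde hga h.mem_Icc k (hm x hx).1).congr_deriv (by
        rw [(h.weights (hm x hx).1 _).1, (h.weights (hm x hx).1 _).2]
        split_ifs <;> ring))) k
  have hm0 : m 0 = y₀ := by
    have := hml y₀ h.mem
    rwa [IsLiouville.ell_self] at this
  have hx0 : (0 : ℝ) ∈ Ioo (-b) b := IsLiouville.ell_self p r y₀ ▸ h.ell_mem h.mem
  have hM : 0 ≤ M := (norm_nonneg _).trans (hQM 0 (Ioo_subset_Icc_self hx0))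
  have htrace : ∀ n, ∀ y ∈ Ioo A B, waveTrace P φ n (ell p r y₀ y) = (rho p r y : ℂ) *
      ∑ k ∈ (Finset.range (n + 1)).filter (fun k => P k),
        (n.choose k : ℂ) * (ell p r y₀ y : ℂ) ^ k * Phi p r g y₀ (n - k) y := by
    intro n y hy
    rw [waveTrace, Finset.mul_sum]
    refine Finset.sum_congr rfl fun k _ => ?_
    rw [hφPhi _ y hy]
    ring
  have hint : ∀ n, ∀ y ∈ Ioo A B, waveIntegral P φ c n (ell p r y₀ y) = (rho p r y : ℂ) *
      ∑ k ∈ (Finset.range (n + 1)).filter (fun k => P k), (n.choose k : ℂ) *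
        Phi p r g y₀ (n - k) y * ∫ t in (0 : ℝ)..ell p r y₀ y, (t : ℂ) ^ k * c t := by
    intro n y hy
    rw [waveIntegral, Finset.mul_sum]
    refine Finset.sum_congr rfl fun k _ => ?_
    rw [hφPhi _ y hy]
    ring
  have hε' : ∀ x ∈ Ioo (-b) b, ‖G (m x) - ∑ n ∈ s, a n * waveTrace P φ n x‖ ≤ ε := by
    intro x hx
    have e : ∀ n, waveTrace P φ n x = (rho p r (m x) : ℂ) *
        ∑ k ∈ (Finset.range (n + 1)).filter (fun k => P k),
          (n.choose k : ℂ) * (x : ℂ) ^ k * Phi p r g y₀ (n - k) (m x) := fun n => by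
      have := htrace n (m x) (hm x hx).1
      rwa [(hm x hx).2] at this
    have h1 := hε (m x) (Ioo_subset_Icc_self (hm x hx).1)
    rw [(hm x hx).2] at h1
    simpa only [e] using h1
  intro y hy
  have key := norm_sub_waveIntegral_le (Q := Q)
    (U := fun x => κ * ((rho p r (m x) : ℂ) * v (m x)))
    (U' := fun x => κ * quasiDeriv p r v (m x)) (G := fun x => G (m x)) (φ := φ)
    hC h0 hω hM hP (hQc.mono Ioo_subset_Icc_self) (fun x hx => hQM x (Ioo_subset_Icc_self hx))
    (fun x hx => (comp hx (h.hasDerivAt_rho_mul hv (hm x hx).1)).const_mul κ)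
    (fun x hx => ((comp hx (h.hasDerivAt_quasiDeriv hQc hQ hv _ (hm x hx).1)).const_mul κ).congr_deriv
      (by rw [(hm x hx).2]; ring))
    (fun x hx k => (hφ x hx k).1) (fun x hx k => (hφ x hx k).2)
    (fun x hx => comp hx ((hG _ (hm x hx).1).congr_deriv (by rw [(hm x hx).2])))
    hc hd hd0 hc0 hc1 (by rw [hm0]; exact hv0) (by rw [hm0]; exact hv'0) hcd s a
    hε'
    (ell p r y₀ y) (h.ell_mem hy)
  simp only [hml y hy, hint _ y hy] at key
  exact key

/-- The integral `∫_0^{l(y)} f` depends continuously on `y`. -/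
theorem continuousOn_integral_ell (h : IsLiouville A B b y₀ p r) {f : ℝ → ℂ} (hf : Continuous f) :
    ContinuousOn (fun y => ∫ t in (0 : ℝ)..ell p r y₀ y, f t) (Icc A B) :=
  (intervalIntegral.continuous_primitive (fun a b => hf.intervalIntegrable a b) 0).comp_continuousOn
    h.continuousOn_ell

theorem continuousOn_one_div_rho (h : IsLiouville A B b y₀ p r) :
    ContinuousOn (fun y => 1 / rho p r y) (Icc A B) :=
  continuousOn_const.div h.rho_cont h.rho_ne_zero

theorem continuousOn_sum_Phi (h : IsLiouville A B b y₀ p r) (hg : IsAdmissible A B p r g)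
    {P : ℕ → Prop} [DecidablePred P] {c : ℝ → ℂ} (hc : Continuous c) (s : Finset ℕ) (a : ℕ → ℂ) :
    ContinuousOn (fun y => 2 * ∑ n ∈ s, a n *
      ∑ k ∈ (Finset.range (n + 1)).filter (fun k => P k), (n.choose k : ℂ) *
        Phi p r g y₀ (n - k) y * ∫ t in (0 : ℝ)..ell p r y₀ y, (t : ℂ) ^ k * c t) (Icc A B) := by
  refine continuousOn_const.mul (continuousOn_finsetSum _ fun n _ => continuousOn_const.mul
    (continuousOn_finsetSum _ fun k _ => ?_))
  exact (continuousOn_const.mul (continuousOn_Phi hg h.mem_Icc _)).mul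
    (continuousOn_integral_ell h (by fun_prop))

theorem continuousOn_comp_ell (h : IsLiouville A B b y₀ p r) {c : ℝ → ℂ} (hc : Continuous c) :
    ContinuousOn (fun y => c (ell p r y₀ y)) (Icc A B) :=
  hc.comp_continuousOn h.continuousOn_ell

theorem abs_one_div_rho_le_maxNorm (h : IsLiouville A B b y₀ p r) {y : ℝ} (hy : y ∈ Icc A B) :
    |1 / rho p r y| ≤ maxNorm A B (fun s => 1 / rho p r s) :=
  le_csSup ((isCompact_Icc.image_of_continuousOn (continuousOn_one_div_rho h).abs).bddAbove)
    ⟨y, hy, rfl⟩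

/-- Division by `ρ` and passage to the closed interval. -/
theorem norm_sub_le_of_norm_rho_mul_le (h : IsLiouville A B b y₀ p r) {v w : ℝ → ℂ} {K : ℝ}
    (hv : ContinuousOn v (Icc A B)) (hw : ContinuousOn w (Icc A B))
    (hK : ∀ y ∈ Ioo A B, ‖(rho p r y : ℂ) * v y - (rho p r y : ℂ) * w y‖ ≤ K) :
    ∀ y ∈ Icc A B, ‖v y - w y‖ ≤ K * maxNorm A B (fun s => 1 / rho p r s) := by
  have hAB : A ≠ B := (h.mem.1.trans h.mem.2).ne
  have hopen : ∀ y ∈ Ioo A B, ‖v y - w y‖ ≤ K * maxNorm A B (fun s => 1 / rho p r s) := by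
    intro y hy
    have hρ := h.rho_pos hy
    have h1 := hK y hy
    have h2 := abs_one_div_rho_le_maxNorm h (Ioo_subset_Icc_self hy)
    rw [← mul_sub, norm_mul, Complex.norm_real, Real.norm_of_nonneg hρ.le] at h1
    have e : ‖v y - w y‖ = (rho p r y * ‖v y - w y‖) * |1 / rho p r y| := by
      rw [abs_of_pos (by positivity)]
      field_simp
    rw [e]
    exact mul_le_mul h1 h2 (abs_nonneg _) ((by positivity : (0 : ℝ) ≤ _).trans h1)
  intro y hy
  -- The equation lives on the open interval only; the endpoints are reached by continuity.
  rw [← closure_Ioo hAB] at hy hv hw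
  exact le_on_closure hopen (hv.sub hw).norm continuousOn_const hy

end Main

/-! ### The cosine and sine approximations -/

section Main

variable {A B b y₀ : ℝ} {p r : ℝ → ℝ} {g : ℝ → ℂ}

/-- The error of `v₁N`. -/
theorem norm_sub_v₁N_le (h : IsLiouville A B b y₀ p r) {q Q : ℝ → ℂ}
    (hQc : ContinuousOn Q (Icc (-b) b)) (hQ : IsPotential A B y₀ p r q Q)
    (hg : IsSolution A B p r q 0 g) (hga : IsAdmissible A B p r g)
    {C M ε : ℝ} {ω : ℂ} (hC : 0 ≤ C) (h0 : ω ≠ 0) (hω : |ω.im| ≤ C)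
    (hQM : ∀ x ∈ Icc (-b) b, ‖Q x‖ ≤ M) {N : ℕ} {a : ℕ → ℂ}
    (hε : ∀ y ∈ Icc A B, ‖G₁ p r q g y₀ y -
      ∑ n ∈ Finset.range (N + 1), a n * cTilde p r g y₀ n y‖ ≤ ε)
    {v : ℝ → ℂ} (hv : IsSolution A B p r q (ω ^ 2) v) (hvc : ContinuousOn v (Icc A B))
    (hv0 : v y₀ = 1 / (rho p r y₀ : ℂ))
    (hv'0 : deriv v y₀ = -((deriv (rho p r) y₀ / rho p r y₀ ^ 2 : ℝ) : ℂ) +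
      hConst p r g y₀ / (rho p r y₀ : ℂ) * (Real.sqrt (r y₀ / p y₀) : ℂ)) :
    ∀ y ∈ Icc A B, ‖v y - v₁N p r g y₀ a N ω y‖ ≤
      6 * ε * Real.exp (M * b ^ 2) * sinhDiv C b * maxNorm A B (fun s => 1 / rho p r s) := by
  have hcont : Continuous fun t : ℝ => Complex.cos (ω * (t : ℂ)) := by fun_prop
  have hρ0 : (rho p r y₀ : ℂ) ≠ 0 := by exact_mod_cast (h.rho_pos h.mem).ne'
  -- The constant h/2 in G₁ is what makes U'(0) = h equal to 2 G₁(y₀) c(0), as the residual estimate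
  -- requires.
  have hG0 : G₁ p r q g y₀ y₀ = hConst p r g y₀ / 2 := by simp [G₁, G₂]
  have hquasi : quasiDeriv p r v y₀ = hConst p r g y₀ := by
    rw [h.quasiDeriv_eq h.mem, hv'0, hv0, (h.hasDerivAt_rho h.mem).deriv]
    obtain ⟨s, t, hs, ht, hp, hr, h1, h2, h3, h4, h5⟩ :=
      exists_fourth_roots (h.p_pos y₀ h.mem) (h.r_pos y₀ h.mem)
    have hs' : (s : ℂ) ≠ 0 := by exact_mod_cast hs.ne'
    have ht' : (t : ℂ) ≠ 0 := by exact_mod_cast ht.ne'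
    rw [rho, h1, h3, hp]
    push_cast
    field_simp
    ring
  have key := norm_rho_mul_sub_le h hQc hQ hg hga hC h0 hω hQM (P := fun k => Even k)
    (fun k => by simp [Nat.even_add]) (c := fun t => Complex.cos (ω * (t : ℂ)))
    (d := fun t => -ω * Complex.sin (ω * (t : ℂ))) (G := G₁ p r q g y₀) (κ := 1) hv
    (fun y hy => (h.hasDerivAt_G₂ hQc hQ hy).const_add _) (hasDerivAt_cos_mul ω)
    (fun x => ((hasDerivAt_sin_mul ω x).const_mul (-ω)).congr_deriv (by ring))
    (by simp) (by simp) (by simp) (by simp [hv0, hρ0]) (by simp [hquasi, hG0]; ring)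
    (fun x s => by
      -- The factor ω in d cancels the 1/ω of the kernel, and the addition formula leaves one
      -- cosine.
      have e : Complex.sin (ω * ((x - s : ℝ) : ℂ)) / ω * (-ω * Complex.sin (ω * (s : ℂ))) -
          Complex.cos (ω * ((x - s : ℝ) : ℂ)) * Complex.cos (ω * (s : ℂ)) =
          -Complex.cos (ω * ((x - 2 * s : ℝ) : ℂ)) := by
        rw [show ω * ((x - 2 * s : ℝ) : ℂ) = ω * ((x - s : ℝ) : ℂ) - ω * (s : ℂ) by
          push_cast; ring, Complex.cos_sub]
        field_simp
        ring
      rw [e, norm_neg]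
      exact norm_cos_mul_le hω _)
    (Finset.range (N + 1)) a hε
  have hinv : ContinuousOn (fun y => 1 / (rho p r y : ℂ)) (Icc A B) := by
    have := Complex.continuous_ofReal.comp_continuousOn (continuousOn_one_div_rho h)
    refine this.congr fun y _ => ?_
    simp
  refine norm_sub_le_of_norm_rho_mul_le h hvc
    ((hinv.mul (continuousOn_comp_ell h hcont)).add (continuousOn_sum_Phi h hga hcont _ a)) ?_
  intro y hy
  have hρ : (rho p r y : ℂ) ≠ 0 := by exact_mod_cast (h.rho_pos hy).ne'
  refine le_trans (le_of_eq ?_) (key y hy)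
  rw [one_mul]
  congr 2
  rw [v₁N, mul_add]
  simp only [Finset.mul_sum]
  congr 1
  · field_simp
  · refine Finset.sum_congr rfl fun n _ => Finset.sum_congr rfl fun k _ => ?_
    ring

/-- The error of `v₂N`. -/
theorem norm_sub_v₂N_le (h : IsLiouville A B b y₀ p r) {q Q : ℝ → ℂ}
    (hQc : ContinuousOn Q (Icc (-b) b)) (hQ : IsPotential A B y₀ p r q Q)
    (hg : IsSolution A B p r q 0 g) (hga : IsAdmissible A B p r g)
    {C M ε : ℝ} {ω : ℂ} (hC : 0 ≤ C) (h0 : ω ≠ 0) (hω : |ω.im| ≤ C)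
    (hQM : ∀ x ∈ Icc (-b) b, ‖Q x‖ ≤ M) {N : ℕ} {β : ℕ → ℂ}
    (hε : ∀ y ∈ Icc A B, ‖G₂ p r q y₀ y -
      ∑ n ∈ Finset.Icc 1 N, β n * sTilde p r g y₀ n y‖ ≤ ε)
    {v : ℝ → ℂ} (hv : IsSolution A B p r q (ω ^ 2) v) (hvc : ContinuousOn v (Icc A B))
    (hv0 : v y₀ = 0)
    (hv'0 : deriv v y₀ = 1 / (rho p r y₀ : ℂ) * (Real.sqrt (r y₀ / p y₀) : ℂ)) :
    ∀ y ∈ Icc A B, ‖v y - v₂N p r g y₀ β N ω y‖ ≤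
      6 * ε * Real.exp (M * b ^ 2) * sinhDiv C b / ‖ω‖ *
        maxNorm A B (fun s => 1 / rho p r s) := by
  have hcont : Continuous fun t : ℝ => Complex.sin (ω * (t : ℂ)) := by fun_prop
  have hG0 : G₂ p r q y₀ y₀ = 0 := by simp [G₂]
  have hquasi : quasiDeriv p r v y₀ = 1 := by
    rw [h.quasiDeriv_eq h.mem, hv'0, hv0]
    obtain ⟨s, t, hs, ht, hp, hr, h1, h2, h3, h4, h5⟩ :=
      exists_fourth_roots (h.p_pos y₀ h.mem) (h.r_pos y₀ h.mem)
    have hs' : (s : ℂ) ≠ 0 := by exact_mod_cast hs.ne'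
    have ht' : (t : ℂ) ≠ 0 := by exact_mod_cast ht.ne'
    rw [rho, h1, h3, hp]
    push_cast
    field_simp
    simp
  -- The multiple κ = ω normalises the solution so that U'(0) = ω = d(0). Dividing it out again
  -- produces the 1/|ω| in the bound.
  have key := norm_rho_mul_sub_le h hQc hQ hg hga hC h0 hω hQM (P := fun k => Odd k)
    (fun k => by simp [Nat.odd_add]) (c := fun t => Complex.sin (ω * (t : ℂ)))
    (d := fun t => ω * Complex.cos (ω * (t : ℂ))) (G := G₂ p r q y₀) (κ := ω) hv
    (fun y hy => h.hasDerivAt_G₂ hQc hQ hy) (hasDerivAt_sin_mul ω)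
    (fun x => ((hasDerivAt_cos_mul ω x).const_mul ω).congr_deriv (by ring))
    (by simp) (by simp) (by simp) (by simp [hv0]) (by simp [hquasi])
    (fun x s => by
      have e : Complex.sin (ω * ((x - s : ℝ) : ℂ)) / ω * (ω * Complex.cos (ω * (s : ℂ))) -
          Complex.cos (ω * ((x - s : ℝ) : ℂ)) * Complex.sin (ω * (s : ℂ)) =
          Complex.sin (ω * ((x - 2 * s : ℝ) : ℂ)) := by
        rw [show ω * ((x - 2 * s : ℝ) : ℂ) = ω * ((x - s : ℝ) : ℂ) - ω * (s : ℂ) by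
          push_cast; ring, Complex.sin_sub]
        field_simp
      rw [e]
      exact norm_sin_mul_le hω _)
    (Finset.Icc 1 N) β hε
  have hinv : ContinuousOn (fun y => (rho p r y : ℂ)) (Icc A B) :=
    Complex.continuous_ofReal.comp_continuousOn h.rho_cont
  have hne : ∀ y ∈ Icc A B, (rho p r y : ℂ) ≠ 0 := fun y hy => by
    exact_mod_cast h.rho_ne_zero y hy
  refine norm_sub_le_of_norm_rho_mul_le h hvc (continuousOn_const.mul
    (((continuousOn_comp_ell h hcont).div hinv hne).add (continuousOn_sum_Phi h hga hcont _ β))) ?_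
  intro y hy
  have hρ := hne y (Ioo_subset_Icc_self hy)
  rw [le_div_iff₀ (norm_pos_iff.2 h0), mul_comm, ← norm_mul]
  refine le_trans (le_of_eq ?_) (key y hy)
  rw [mul_sub]
  congr 2
  have e : ∀ X Z : ℂ, ω * ((rho p r y : ℂ) * (1 / ω * (X / (rho p r y : ℂ) + Z))) =
      X + (rho p r y : ℂ) * Z := fun X Z => by field_simp
  rw [v₂N, e]
  congr 1
  simp only [Finset.mul_sum]
  refine Finset.sum_congr rfl fun n _ => Finset.sum_congr rfl fun k _ => ?_
  ring

end Main

end Liouville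

theorem mainTheorem4 (b : ℝ) (hb : 0 < b) (Q : ℝ → ℂ) (hQ : ContinuousOn Q (Icc (-b) b)) :
    ∃ ε : ℝ → ℝ → ℝ,
      (∀ ε₁ ε₂ : ℝ, 0 ≤ ε ε₁ ε₂) ∧
      Tendsto (fun e : ℝ × ℝ => ε e.1 e.2) (𝓝 (0, 0)) (𝓝 0) ∧
      ∀ (A B y₀ : ℝ) (p r : ℝ → ℝ) (q g : ℝ → ℂ),
        Liouville.IsLiouville A B b y₀ p r →
        Liouville.IsPotential A B y₀ p r q Q →
        Liouville.IsSolution A B p r q 0 g →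
        Liouville.IsAdmissible A B p r g →
        g y₀ = (((p y₀ * r y₀) ^ (-(1 / 4) : ℝ) : ℝ) : ℂ) →
        ∀ (N : ℕ) (a β : ℕ → ℂ) (ε₁ ε₂ : ℝ),
          (∀ y ∈ Icc A B, ‖Liouville.G₁ p r q g y₀ y -
            ∑ n ∈ Finset.range (N + 1), a n * Liouville.cTilde p r g y₀ n y‖ ≤ ε₁) →
          (∀ y ∈ Icc A B, ‖Liouville.G₂ p r q y₀ y -
            ∑ n ∈ Finset.Icc 1 N, β n * Liouville.sTilde p r g y₀ n y‖ ≤ ε₂) →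
          ∀ (C : ℝ) (ω : ℂ), 0 ≤ C → ω ≠ 0 → |ω.im| ≤ C →
            (∀ v₁ : ℝ → ℂ,
              Liouville.IsSolution A B p r q (ω ^ 2) v₁ →
              ContinuousOn v₁ (Icc A B) →
              v₁ y₀ = 1 / (Liouville.rho p r y₀ : ℂ) →
              deriv v₁ y₀ =
                -((deriv (Liouville.rho p r) y₀ / Liouville.rho p r y₀ ^ 2 : ℝ) : ℂ) +
                  Liouville.hConst p r g y₀ / (Liouville.rho p r y₀ : ℂ) *
                    (Real.sqrt (r y₀ / p y₀) : ℂ) →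
              ∀ y ∈ Icc A B, ‖v₁ y - Liouville.v₁N p r g y₀ a N ω y‖ ≤
                ε ε₁ ε₂ * Liouville.maxNorm A B (fun s => 1 / Liouville.rho p r s) *
                  Liouville.sinhDiv C b) ∧
            (∀ v₂ : ℝ → ℂ,
              Liouville.IsSolution A B p r q (ω ^ 2) v₂ →
              ContinuousOn v₂ (Icc A B) →
              v₂ y₀ = 0 →
              deriv v₂ y₀ =
                1 / (Liouville.rho p r y₀ : ℂ) * (Real.sqrt (r y₀ / p y₀) : ℂ) →
              ∀ y ∈ Icc A B, ‖v₂ y - Liouville.v₂N p r g y₀ β N ω y‖ ≤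
                ε ε₁ ε₂ * Liouville.maxNorm A B (fun s => 1 / Liouville.rho p r s) *
                  (Liouville.sinhDiv C b / ‖ω‖)) := by
  obtain ⟨M, hM⟩ := isCompact_Icc.exists_bound_of_continuousOn hQ
  -- M bounds |Q| on [-b, b], so the witness involves only Q, b, ε₁ and ε₂. Absolute values make it
  -- nonnegative for all real arguments, and the sum serves both estimates.
  refine ⟨fun ε₁ ε₂ => 6 * (|ε₁| + |ε₂|) * Real.exp (M * b ^ 2), fun _ _ => by positivity, ?_, ?_⟩
  · have : Continuous fun e : ℝ × ℝ => 6 * (|e.1| + |e.2|) * Real.exp (M * b ^ 2) := by fun_prop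
    simpa using this.tendsto (0, 0)
  intro A B y₀ p r q g h hpot hg hga _ N a β ε₁ ε₂ hε₁ hε₂ C ω hC h0 hω
  have hs : 0 ≤ Liouville.sinhDiv C b := Liouville.sinhDiv_nonneg C hb.le
  have hm : 0 ≤ Liouville.maxNorm A B (fun s => 1 / Liouville.rho p r s) :=
    (abs_nonneg _).trans (Liouville.abs_one_div_rho_le_maxNorm h h.mem_Icc)
  have h₁ : ε₁ ≤ |ε₁| + |ε₂| := (le_abs_self _).trans (le_add_of_nonneg_right (abs_nonneg _))
  have h₂ : ε₂ ≤ |ε₁| + |ε₂| := (le_abs_self _).trans (le_add_of_nonneg_left (abs_nonneg _))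
  refine ⟨fun v hv hvc hv0 hv'0 y hy => ?_, fun v hv hvc hv0 hv'0 y hy => ?_⟩
  · refine (Liouville.norm_sub_v₁N_le h hQ hpot hg hga hC h0 hω hM hε₁ hv hvc hv0 hv'0 y hy).trans ?_
    calc _ ≤ 6 * (|ε₁| + |ε₂|) * Real.exp (M * b ^ 2) * Liouville.sinhDiv C b *
          Liouville.maxNorm A B (fun s => 1 / Liouville.rho p r s) := by gcongr
      _ = _ := by ring
  · refine (Liouville.norm_sub_v₂N_le h hQ hpot hg hga hC h0 hω hM hε₂ hv hvc hv0 hv'0 y hy).trans ?_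
    calc _ ≤ 6 * (|ε₁| + |ε₂|) * Real.exp (M * b ^ 2) * Liouville.sinhDiv C b / ‖ω‖ *
          Liouville.maxNorm A B (fun s => 1 / Liouville.rho p r s) := by gcongr
      _ = _ := by ring
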